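/- Let $\mathbb R_+=(0,\infty)$ and let $G=\{(u,v):u\in\mathbb R,\ v>0\}$ carry the measure $d\nu=v^{-2}\,du\,dv$. For $k\in\{0,1,2,\dots\}$ let $L_k$ be the Laguerre polynomial of degree $k$ (type $0$), $\ell_k(y)=e^{-y/2}L_k(y)$, and let $\psi^{(k)}\in L_2(\mathbb R)$ be the wavelet with Fourier transform $\hat\psi^{(k)}(\xi)=\chi_{\mathbb R_+}(\xi)\sqrt{2\xi}\,\ell_k(2\xi)$, where $\hat g(\xi)=\int_{\mathbb R} g(x)e^{-2\pi i x\xi}\,dx$. Put $\psi_v(u)=v^{-1/2}\psi(u/v)$ and, for $f$ in the Hardy space $H_2^+(\mathbb R)=\{f\in L_2(\mathbb R):\operatorname{supp}\hat f\subseteq[0,\infty)\}$, put $(W_kf)(u,v)=(f*\psi^{(k)}_v)(u)$. Let $A^{(k)}=\{W_kf: f\in H_2^+(\mathbb R)\}\subseteq L_2(G,d\nu)$, let $P^{(k)}$ be the orthogonal projection of $L_2(G,d\nu)$ onto $A^{(k)}$, and for $a\in L_\infty(\mathbb R_+)$ let $T_a^{(k)}:A^{(k)}\to A^{(k)}$,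 $T_a^{(k)}F=P^{(k)}(aF)$, with $a=a(v)$, be the Calderón–Toeplitz operator with symbol $a$. **Theorem.** Let $k\ge 0$, let $\lambda>0$, and let $a\in L_\infty(\mathbb R_+)$ be complex-valued with (essential) limits $a_0=\lim_{v\to0}a(v)$ and $a_\infty=\lim_{v\to+\infty}a(v)$. For $0<x<1$ put $$\nabla_{a,\lambda}^{(k)}(x)=-\frac1\lambda\ln(1-x)\int_{\mathbb R_+}a(v)(1-x)^{v/\lambda}L_k^2\Bigl(-\frac v\lambda\ln(1-x)\Bigr)\,dv .$$ Then all the spaces $A^{(j)}$ are closed, the integral converges absolutely, and $\nabla_{a,\lambda}^{(k)}$ extends to a continuous function on $[0,1]$ with the values $a_\infty$ at $0$ and $a_0$ at $1$. The operator $T^{(0)}_{\chi_{[0,\lambda]}}$ on $A^{(0)}$ is self-adjoint with spectrum $[0,1]$. There is a unitary operator $V:A^{(0)}\to A^{(k)}$ with $V(W_0f)=W_kf$ for all $f\in H_2^+(\mathbb R)$, and, in the sense of the continuous functional calculus, $$V\,\nabla_{a,\lambda}^{(k)}\bigl(T^{(0)}_{\chi_{[0,\lambda]}}\bigr)\,V^{-1}=T_a^{(k)}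 .$$ That is, when the levels $0$ and $k$ are identified through the wavelet transforms (for $k=0$ this is the identity), $\nabla_{a,\lambda}^{(k)}\bigl(T^{(0)}_{\chi_{[0,\lambda]}}\bigr)=T_a^{(k)}$, so $T_a^{(k)}$ is a function of $T^{(0)}_{\chi_{[0,\lambda]}}$. -/

import Mathlib

open MeasureTheory Set Filter Topology
open scoped ENNReal FourierTransform Convolution

noncomputable section

namespace CalderonToeplitz

/-- The Laguerre polynomial `L_k` of type `0`, as a function on `ℝ`. -/
def laguerre (k : ℕ) (y : ℝ) : ℝ :=
  ∑ i ∈ Finset.range (k + 1), (-1) ^ i * (k.choose i : ℝ) * (y ^ i / (i.factorial : ℝ))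

/-- The Laguerre function `ℓ_k(y) = e^{-y/2} L_k(y)`. -/
def laguerreFun (k : ℕ) (y : ℝ) : ℝ := Real.exp (-y / 2) * laguerre k y

/-- The function `χ₊(ξ) √(2ξ) ℓ_k(2ξ)`, the Fourier transform of the wavelet of order `k`. -/
def psiHat (k : ℕ) (ξ : ℝ) : ℂ :=
  (Ioi (0 : ℝ)).indicator (fun ξ => ((Real.sqrt (2 * ξ) * laguerreFun k (2 * ξ) : ℝ) : ℂ)) ξ

theorem continuous_laguerreFun (k : ℕ) : Continuous (laguerreFun k) := by
  unfold laguerreFun laguerre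
  fun_prop

theorem isBigO_laguerre (k : ℕ) :
    (fun ξ : ℝ => laguerre k (2 * ξ)) =O[atTop] fun ξ => Real.exp ((1 / 4 : ℝ) * ξ) := by
  unfold laguerre
  refine Asymptotics.IsBigO.fun_sum fun i _ => ?_
  have h := (isLittleO_pow_exp_pos_mul_atTop i (b := (1 / 4 : ℝ)) (by norm_num)).isBigO
  refine (h.const_mul_left ((-1) ^ i * (k.choose i : ℝ) * (2 ^ i / (i.factorial : ℝ)))).congr_left
    fun ξ => ?_
  rw [mul_pow]
  ring

theorem memLp_psiHat (k : ℕ) : MemLp (psiHat k) 2 (volume : Measure ℝ) := by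
  have hcont : Continuous
      fun ξ : ℝ => ((Real.sqrt (2 * ξ) * laguerreFun k (2 * ξ) : ℝ) : ℂ) := by
    have := continuous_laguerreFun k
    fun_prop
  change MemLp ((Ioi (0 : ℝ)).indicator _) 2 volume
  rw [memLp_indicator_iff_restrict measurableSet_Ioi,
    memLp_two_iff_integrable_sq_norm hcont.aestronglyMeasurable]
  refine integrable_of_isBigO_exp_neg (b := 1) one_pos
    (hcont.norm.pow 2).continuousOn ?_
  have h1 := isBigO_laguerre k
  have h0 : (fun ξ : ℝ => ξ) =O[atTop] fun ξ => Real.exp ((1 / 2 : ℝ) * ξ) := by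
    simpa using (isLittleO_pow_exp_pos_mul_atTop 1 (b := (1 / 2 : ℝ)) (by norm_num)).isBigO
  have h2 := (((h0.const_mul_left 2).mul (h1.mul h1)).mul
    (Asymptotics.isBigO_refl (fun ξ : ℝ => Real.exp (-2 * ξ)) atTop))
  refine h2.congr' ?_ ?_
  · filter_upwards [eventually_ge_atTop 0] with ξ hξ
    rw [Complex.norm_real, Real.norm_eq_abs, sq_abs, mul_pow, Real.sq_sqrt (by positivity),
      laguerreFun, mul_pow, ← Real.exp_nat_mul]
    have : ((2 : ℕ) : ℝ) * (-(2 * ξ) / 2) = -2 * ξ := by push_cast; ring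
    rw [this]
    ring
  · filter_upwards with ξ
    rw [← Real.exp_add, ← Real.exp_add, ← Real.exp_add]
    congr 1
    ring

/-- The wavelet `ψ^{(k)} ∈ L₂(ℝ)`, defined on the Fourier transform side. -/
def psi (k : ℕ) : Lp ℂ 2 (volume : Measure ℝ) := 𝓕⁻ (memLp_psiHat k).toLp

/-- The dilation `ψ_v(u) = v^{-1/2} ψ(u / v)`. -/
def dilate (v : ℝ) (g : ℝ → ℂ) (u : ℝ) : ℂ := ((Real.sqrt v)⁻¹ : ℝ) * g (u / v)

/-- The continuous wavelet transform `(W_k f)(u, v) = (f * ψ_v^{(k)})(u)`; the point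
`(u, v)`, `v > 0`, of the affine group is the pair `p`. -/
def waveletTransform (k : ℕ) (f : Lp ℂ 2 (volume : Measure ℝ)) (p : ℝ × ℝ) : ℂ :=
  ((f : ℝ → ℂ) ⋆[ContinuousLinearMap.mul ℂ ℂ, volume] dilate p.2 (psi k)) p.1

/-- The Hardy space `H₂⁺(ℝ)`: all `h ∈ L₂(ℝ)` whose Fourier transform is supported in
`[0, ∞)`. -/
def hardySpace : Submodule ℂ (Lp ℂ 2 (volume : Measure ℝ)) where
  carrier := {h | ∀ᵐ ξ : ℝ, ξ < 0 → (𝓕 h : Lp ℂ 2 (volume : Measure ℝ)) ξ = 0}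
  zero_mem' := by
    have h0 : (𝓕 (0 : Lp ℂ 2 (volume : Measure ℝ)) : Lp ℂ 2 (volume : Measure ℝ)) = 0 :=
      (Lp.fourierTransformₗᵢ ℝ ℂ).map_zero
    simp only [mem_ofPred_eq, h0]
    filter_upwards [Lp.coeFn_zero ℂ 2 (volume : Measure ℝ)] with ξ hξ _
    exact hξ
  add_mem' := by
    intro f g hf hg
    have h0 : (𝓕 (f + g) : Lp ℂ 2 (volume : Measure ℝ)) = 𝓕 f + 𝓕 g :=
      (Lp.fourierTransformₗᵢ ℝ ℂ).map_add f g
    simp only [mem_ofPred_eq, h0] at hf hg ⊢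
    filter_upwards [hf, hg, Lp.coeFn_add (𝓕 f : Lp ℂ 2 (volume : Measure ℝ)) (𝓕 g)]
      with ξ h1 h2 h3 hξ
    rw [h3, Pi.add_apply, h1 hξ, h2 hξ, add_zero]
  smul_mem' := by
    intro c f hf
    have h0 : (𝓕 (c • f) : Lp ℂ 2 (volume : Measure ℝ)) = c • 𝓕 f :=
      (Lp.fourierTransformₗᵢ ℝ ℂ).map_smul c f
    simp only [mem_ofPred_eq, h0] at hf ⊢
    filter_upwards [hf, Lp.coeFn_smul c (𝓕 f : Lp ℂ 2 (volume : Measure ℝ))] with ξ h1 h3 hξ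
    rw [h3, Pi.smul_apply, h1 hξ, smul_zero]

/-- Lebesgue measure on `ℝ₊ = (0, ∞)`. -/
abbrev halfLine : Measure ℝ := volume.restrict (Ioi 0)

/-- The left Haar measure `dν = v⁻² du dv` of the affine group
`G = {(u, v) : u ∈ ℝ, v > 0}`, as a measure on `ℝ × ℝ` that vanishes outside `G`. -/
def affineHaar : Measure (ℝ × ℝ) :=
  (volume : Measure ℝ).prod (halfLine.withDensity fun v => ENNReal.ofReal (v ^ 2)⁻¹)

theorem memLp_dilate_psi (k : ℕ) {v : ℝ} (hv : 0 < v) :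
    MemLp (dilate v (psi k)) 2 (volume : Measure ℝ) := by
  unfold dilate
  refine MemLp.const_mul ?_ _
  have hmap : Measure.map (fun u : ℝ => u / v) volume = ENNReal.ofReal v • volume := by
    simp_rw [div_eq_mul_inv]
    rw [Real.map_volume_mul_right (inv_ne_zero hv.ne'), inv_inv, abs_of_pos hv]
  have h : MemLp (psi k) 2 (Measure.map (fun u : ℝ => u / v) volume) := by
    rw [hmap]
    exact (Lp.memLp (psi k)).smul_measure ENNReal.ofReal_ne_top
  exact h.comp_of_map (by fun_prop)

theorem convolutionExists (k : ℕ) (f : Lp ℂ 2 (volume : Measure ℝ)) (u : ℝ) {v : ℝ}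
    (hv : 0 < v) :
    ConvolutionExistsAt (f : ℝ → ℂ) (dilate v (psi k)) u (ContinuousLinearMap.mul ℂ ℂ)
      volume := by
  have h : MemLp (fun t => dilate v (psi k) (u - t)) 2 (volume : Measure ℝ) :=
    (memLp_dilate_psi k hv).comp_measurePreserving
      (Measure.measurePreserving_sub_left volume u)
  exact (Lp.memLp f).integrable_mul h

theorem ae_affineHaar_pos : ∀ᵐ p ∂affineHaar, 0 < p.2 := by
  have h : ∀ᵐ v ∂(halfLine.withDensity fun v => ENNReal.ofReal (v ^ 2)⁻¹), 0 < v :=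
    (withDensity_absolutelyContinuous _ _).ae_le (ae_restrict_mem measurableSet_Ioi)
  exact Measure.quasiMeasurePreserving_snd.ae h

/-- The wavelet subspace `A^{(k)} = {W_k f : f ∈ H₂⁺(ℝ)}` of `L₂(G, dν)`. -/
def waveletSubspace (k : ℕ) : Submodule ℂ (Lp ℂ 2 affineHaar) where
  carrier := {F | ∃ f ∈ hardySpace, F =ᵐ[affineHaar] waveletTransform k f}
  zero_mem' := by
    refine ⟨0, zero_mem _, ?_⟩
    filter_upwards [Lp.coeFn_zero ℂ 2 affineHaar] with p hp
    have h0 := Lp.coeFn_zero ℂ 2 (volume : Measure ℝ)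
    rw [hp, waveletTransform, convolution_def, integral_eq_zero_of_ae]
    · rfl
    · filter_upwards [h0] with t ht
      rw [ht, Pi.zero_apply, map_zero]
      rfl
  add_mem' := by
    rintro F₁ F₂ ⟨f₁, hf₁, h₁⟩ ⟨f₂, hf₂, h₂⟩
    refine ⟨f₁ + f₂, add_mem hf₁ hf₂, ?_⟩
    filter_upwards [Lp.coeFn_add F₁ F₂, h₁, h₂, ae_affineHaar_pos] with p hp h1 h2 hv
    rw [hp, Pi.add_apply, h1, h2]
    simp only [waveletTransform, convolution_def]
    rw [← integral_add (convolutionExists k f₁ p.1 hv) (convolutionExists k f₂ p.1 hv)]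
    refine integral_congr_ae ?_
    filter_upwards [Lp.coeFn_add f₁ f₂] with t ht
    rw [ht, Pi.add_apply, map_add]
    rfl
  smul_mem' := by
    rintro c F ⟨f, hf, h⟩
    refine ⟨c • f, Submodule.smul_mem _ c hf, ?_⟩
    filter_upwards [Lp.coeFn_smul c F, h] with p hp h1
    rw [hp, Pi.smul_apply, h1]
    simp only [waveletTransform, convolution_def]
    rw [← integral_smul]
    refine integral_congr_ae ?_
    filter_upwards [Lp.coeFn_smul c f] with t ht
    rw [ht, Pi.smul_apply, map_smul]
    rfl

/-- The operator `M_a` of pointwise multiplication by `a ∈ L_∞(G)` on `L₂(G, dν)`. -/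
def mulOp (a : Lp ℂ ∞ affineHaar) : Lp ℂ 2 affineHaar →L[ℂ] Lp ℂ 2 affineHaar :=
  (ContinuousLinearMap.mul ℂ ℂ).holderL affineHaar ∞ 2 2 a

/-- The Calderón–Toeplitz operator `T_a^{(k)} = P^{(k)} M_a` on `A^{(k)}`, where `P^{(k)}` is the
orthogonal projection of `L₂(G, dν)` onto `A^{(k)}`. -/
def toeplitz (k : ℕ) [CompleteSpace (waveletSubspace k)] (a : Lp ℂ ∞ affineHaar) :
    waveletSubspace k →L[ℂ] waveletSubspace k :=
  (waveletSubspace k).orthogonalProjectionOnto ∘L mulOp a ∘L (waveletSubspace k).subtypeL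

theorem memLp_vertical {a : ℝ → ℂ} (ha : MemLp a ∞ halfLine) :
    MemLp (fun p : ℝ × ℝ => a p.2) ∞ affineHaar := by
  have hq : Measure.QuasiMeasurePreserving Prod.snd affineHaar halfLine :=
    Measure.quasiMeasurePreserving_snd.mono_right (withDensity_absolutelyContinuous _ _)
  refine ⟨ha.1.comp_quasiMeasurePreserving hq, ?_⟩
  refine lt_of_le_of_lt ?_ ha.2
  rw [eLpNorm_exponent_top, eLpNorm_exponent_top]
  exact limsup_le_limsup_of_le (u := fun v => ‖a v‖ₑ) hq.tendsto_ae

/-- The symbol `(u, v) ↦ a(v)` on `G` given by an essentially bounded function `a` on `ℝ₊`. -/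
def verticalSymbol {a : ℝ → ℂ} (ha : MemLp a ∞ halfLine) : Lp ℂ ∞ affineHaar :=
  (memLp_vertical ha).toLp

/-- The continuous functional calculus `f(T)` for a normal operator `T` on a Hilbert space. -/
def opCfc {E : Type*} [NormedAddCommGroup E] [InnerProductSpace ℂ E] [CompleteSpace E]
    (f : ℂ → ℂ) (T : E →L[ℂ] E) : E →L[ℂ] E := cfc f T

/-- The characteristic function `χ_{[0,lam]}`. -/
def chi (lam : ℝ) : ℝ → ℂ := (Icc 0 lam).indicator fun _ => 1

theorem memLp_chi (lam : ℝ) : MemLp (chi lam) ∞ halfLine :=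
  (memLp_top_const (1 : ℂ)).indicator measurableSet_Icc

/-- The integrand `a(v) (1-x)^{v/lam} L_k²(-(v/lam) ln(1-x))`. -/
def nablaIntegrand (a : ℝ → ℂ) (lam : ℝ) (k : ℕ) (x v : ℝ) : ℂ :=
  a v * (((1 - x) ^ (v / lam) * laguerre k (-(v / lam) * Real.log (1 - x)) ^ 2 : ℝ) : ℂ)

/-- The function `∇_{a,lam}^{(k)}`, meant for `0 < x < 1`, where the formula makes sense. -/
def nabla (a : ℝ → ℂ) (lam : ℝ) (k : ℕ) (x : ℝ) : ℂ :=
  ((-(1 / lam) * Real.log (1 - x) : ℝ) : ℂ) * ∫ v in Ioi (0 : ℝ), nablaIntegrand a lam k x v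

end CalderonToeplitz

end

open CalderonToeplitz

/-!
The Fourier transform in the variable `u` turns the convolution `f * ψ_v` into the product of `f̂`
with `v √(2ξ) ℓ_k(2ξv)` on `ξ > 0`. By Plancherel's theorem on each line `v = const` and Fubini's
theorem, for `f ∈ H₂⁺(ℝ)` and a bounded symbol `a(v)`,
`∫ a(v) |W_k f|² dν = ∫ γ_a(ξ) |f̂(ξ)|² dξ` with `γ_a(ξ) = ∫ a(v) 2ξ ℓ_k(2ξv)² dv`
(`integral_mul_norm_synthesis_sq`, with `γ_a` named `spectralFunction`).

For `a = 1` one has `γ_a = 1`, because `ℓ_k` has norm `1` in `L²(ℝ₊)`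
(`integral_laguerreFun_sq`). Hence `f̂ ↦ W_k f` is an isometry of `L²(ℝ₊)` onto `A^{(k)}`
(`waveletEquiv`), so `A^{(k)}` is closed, and `V` is the composition of two of these unitary
operators. For general `a` the identity compares quadratic forms, and says that `T_a^{(k)}`
corresponds to the multiplication by `γ_a` on `L²(ℝ₊)` (`conj_waveletEquiv_expHom`).

For `k = 0` and `a = χ_{[0,λ]}` the integral is `γ_a(ξ) = 1 - e^{-2λξ}`
(`spectralFunction_chi`), an increasing bijection of `(0, ∞)` onto `(0, 1)`. Substituting
`x = 1 - e^{-2λξ}` in the definition of `∇` gives `∇(x) = γ_a(ξ)`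
(`nabla_eq_spectralFunction`). So `T_a^{(k)}` corresponds to the multiplication by
`∇(1 - e^{-2λξ})`, which is the function `∇` of the multiplication by `1 - e^{-2λξ}`: the
multiplications by `h(1 - e^{-2λξ})`, `h ∈ C([0, 1])`, form a faithful representation of
`C([0, 1])`, and such a representation preserves spectra and commutes with the functional calculus.
The limits of `∇` at `0` and `1` are those of `γ_a` at `0` and `∞`; they hold since `γ_a(ξ)` is the
mean of `y ↦ a(y / 2ξ)` for the probability density `ℓ_k²` (`tendsto_spectralFunction`).
-/

noncomputable section

/-! ### The inverse Fourier transform on `L¹ ∩ L²` -/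

/-- The inverse Fourier transform of an integrable function is continuous. -/
theorem continuous_fourierInv {h : ℝ → ℂ} (h1 : Integrable h) : Continuous (𝓕⁻ h) :=
  VectorFourier.fourierIntegral_continuous Real.continuous_fourierChar
    (by simp only [LinearMap.neg_apply, innerₗ_apply_apply]; fun_prop) h1

/-- The multiplication formula for the inverse Fourier transform. -/
theorem integral_fourierInv_mul {g h : ℝ → ℂ} (hg : Integrable g) (hh : Integrable h) :
    ∫ x, 𝓕⁻ g x * h x = ∫ x, g x * 𝓕⁻ h x := by
  have := VectorFourier.integral_fourierIntegral_smul_eq_flip (μ := volume) (ν := volume)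
    (L := -innerₗ ℝ) Real.continuous_fourierChar
    (by simp only [LinearMap.neg_apply, innerₗ_apply_apply]; fun_prop) hg hh
  have hf : (-innerₗ ℝ).flip = -innerₗ ℝ := by
    ext; simp
  rw [hf] at this
  exact this

/-- The inverse Fourier transform of `L²` is given by the Fourier integral on `L¹ ∩ L²`: both define
the same tempered distribution. -/
theorem fourierInv_toLp_ae_eq {h : ℝ → ℂ} (h1 : Integrable h) (h2 : MemLp h 2 volume) :
    ((𝓕⁻ (h2.toLp h) : Lp ℂ 2 (volume : Measure ℝ)) : ℝ → ℂ) =ᵐ[volume] 𝓕⁻ h := by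
  refine ae_eq_of_integral_contDiff_smul_eq
    ((Lp.memLp _).locallyIntegrable one_le_two) (continuous_fourierInv h1).locallyIntegrable
    fun g hg hgs => ?_
  let G : SchwartzMap ℝ ℂ := (hgs.comp_left (g := Complex.ofReal) rfl).toSchwartzMap
    (Complex.ofRealCLM.contDiff.comp hg)
  have hG : ∀ x, G x = (g x : ℂ) := fun x => rfl
  have e2 := congrArg (fun D : TemperedDistribution ℝ ℂ => D G)
    (Lp.fourierInv_toTemperedDistribution_eq (h2.toLp h))
  simp only [TemperedDistribution.fourierInv_apply, Lp.toTemperedDistribution_apply,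
    SchwartzMap.fourierInv_coe, smul_eq_mul] at e2
  have e3 : ∫ x, 𝓕⁻ (⇑G) x * h2.toLp h x = ∫ x, 𝓕⁻ (⇑G) x * h x :=
    integral_congr_ae (h2.coeFn_toLp.mono fun x hx => by simp only [hx])
  rw [e3, integral_fourierInv_mul G.integrable h1] at e2
  simp only [hG] at e2
  simpa only [Complex.real_smul] using e2.symm

theorem memLp_fourierInv {h : ℝ → ℂ} (h1 : Integrable h) (h2 : MemLp h 2 volume) :
    MemLp (𝓕⁻ h) 2 volume :=
  (memLp_congr_ae (fourierInv_toLp_ae_eq h1 h2)).mp (Lp.memLp _)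

theorem inner_self_eq_integral_norm_sq {α : Type*} {_ : MeasurableSpace α} {μ : Measure α}
    (F : Lp ℂ 2 μ) : inner ℂ F F = ((∫ x, ‖F x‖ ^ 2 ∂μ : ℝ) : ℂ) := by
  rw [L2.inner_def, ← integral_complex_ofReal]
  refine integral_congr_ae (.of_forall fun x => ?_)
  simp [inner_self_eq_norm_sq_to_K]

/-- Plancherel's theorem for the Fourier integral of a function in `L¹ ∩ L²`. -/
theorem integral_norm_fourierInv_sq {h : ℝ → ℂ} (h1 : Integrable h) (h2 : MemLp h 2 volume) :
    ∫ x, ‖𝓕⁻ h x‖ ^ 2 = ∫ x, ‖h x‖ ^ 2 := by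
  have h3 : inner ℂ (𝓕⁻ (h2.toLp h) : Lp ℂ 2 (volume : Measure ℝ)) (𝓕⁻ (h2.toLp h)) =
      inner ℂ (h2.toLp h) (h2.toLp h) := (Lp.fourierTransformₗᵢ ℝ ℂ).symm.inner_map_map _ _
  rw [inner_self_eq_integral_norm_sq, inner_self_eq_integral_norm_sq, Complex.ofReal_inj] at h3
  calc ∫ x, ‖𝓕⁻ h x‖ ^ 2
      = ∫ x, ‖(𝓕⁻ (h2.toLp h) : Lp ℂ 2 (volume : Measure ℝ)) x‖ ^ 2 :=
        integral_congr_ae ((fourierInv_toLp_ae_eq h1 h2).mono fun x hx => by simp only [hx])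
    _ = ∫ x, ‖h2.toLp h x‖ ^ 2 := h3
    _ = ∫ x, ‖h x‖ ^ 2 := integral_congr_ae (h2.coeFn_toLp.mono fun x hx => by simp only [hx])

theorem ae_norm_le_of_memLp_top {α : Type*} {_ : MeasurableSpace α} {μ : Measure α} {f : α → ℂ}
    (hf : MemLp f ∞ μ) : ∀ᵐ x ∂μ, ‖f x‖ ≤ (eLpNorm f ∞ μ).toReal := by
  filter_upwards [ae_le_eLpNormEssSup (f := f) (μ := μ)] with x hx
  rw [← eLpNorm_exponent_top] at hx
  simpa using ENNReal.toReal_mono hf.2.ne hx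

/-! ### Laguerre functions -/

/-- Up to the sign `(-1)^k`, the sum is the `k`-th finite difference at `0` of `j ↦ C(i + j, i)`,
which is a polynomial of degree `i` in `j` with leading coefficient `1 / i!`. -/
theorem sum_neg_one_pow_mul_choose_mul_choose_add {i k : ℕ} (h : i ≤ k) :
    ∑ j ∈ Finset.range (k + 1), (-1 : ℤ) ^ j * k.choose j * (i + j).choose i =
      if i = k then (-1) ^ k else 0 := by
  have h1 := fwdDiff_iter_eq_sum_shift (h := 1) (fun x : ℕ => (x.choose i : ℤ)) k i
  have h2 : (fwdDiff 1)^[k] (fun x : ℕ => (x.choose i : ℤ)) i = if i = k then 1 else 0 := by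
    obtain ⟨m, rfl⟩ := Nat.exists_eq_add_of_le h
    have h0 : (fwdDiff 1)^[i] (fun x : ℕ => (x.choose i : ℤ)) = fun _ => 1 := by
      simpa using fwdDiff_iter_choose 0 i
    rw [add_comm i m, Function.iterate_add_apply, h0]
    rcases m with - | m
    · simp
    · rw [if_neg (by lia), Function.iterate_succ_apply, fwdDiff_const]
      have h0' : fwdDiff 1 (fun _ : ℕ => (0 : ℤ)) = fun _ => 0 := fwdDiff_const 1 0
      rw [Function.iterate_fixed h0']
  rw [h2] at h1
  calc _ = (-1) ^ k * ∑ j ∈ Finset.range (k + 1),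
        ((-1 : ℤ) ^ (k - j) * k.choose j) • ((i + j • 1).choose i : ℤ) := by
        rw [Finset.mul_sum]
        refine Finset.sum_congr rfl fun j hj => ?_
        have hj' : j ≤ k := Nat.lt_succ_iff.mp (Finset.mem_range.mp hj)
        obtain ⟨m, rfl⟩ := Nat.exists_eq_add_of_le hj'
        have : (-1 : ℤ) ^ m * (-1) ^ m = 1 := by rw [← mul_pow]; simp
        simp only [add_tsub_cancel_left, smul_eq_mul, mul_one, pow_add]
        linear_combination (-1 : ℤ) ^ j * ((j + m).choose j) * ((i + j).choose i) * (-this)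
    _ = _ := by rw [← h1]; split_ifs <;> simp

/-- The bound comes from `y ^ i / i! ≤ 4 ^ i e^{y/4}` and `∑ C(k, i) 4 ^ i = 5 ^ k`. -/
theorem abs_laguerre_le (k : ℕ) {y : ℝ} (hy : 0 ≤ y) :
    |laguerre k y| ≤ 5 ^ k * Real.exp (y / 4) := by
  unfold laguerre
  calc _ ≤ ∑ i ∈ Finset.range (k + 1),
          |(-1) ^ i * (k.choose i : ℝ) * (y ^ i / (i.factorial : ℝ))| :=
        Finset.abs_sum_le_sum_abs _ _
    _ ≤ ∑ i ∈ Finset.range (k + 1), 4 ^ i * 1 ^ (k - i) * (k.choose i : ℝ) * Real.exp (y / 4) := by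
        refine Finset.sum_le_sum fun i _ => ?_
        have h1 := Real.pow_div_factorial_le_exp (y / 4) (by positivity) i
        rw [abs_mul, abs_mul, abs_pow, abs_neg, abs_one, one_pow, one_mul,
          abs_of_nonneg (by positivity), abs_of_nonneg (by positivity)]
        calc (k.choose i : ℝ) * (y ^ i / i.factorial)
            = (k.choose i : ℝ) * 4 ^ i * ((y / 4) ^ i / i.factorial) := by
              rw [div_pow]; field_simp
          _ ≤ (k.choose i : ℝ) * 4 ^ i * Real.exp (y / 4) := by gcongr
          _ = _ := by ring
    _ = _ := by
        rw [← Finset.sum_mul, ← add_pow]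
        norm_num

theorem abs_laguerreFun_le (k : ℕ) {y : ℝ} (hy : 0 ≤ y) :
    |laguerreFun k y| ≤ 5 ^ k * Real.exp (-(y / 4)) := by
  rw [laguerreFun, abs_mul, abs_of_pos (Real.exp_pos _)]
  calc _ ≤ Real.exp (-y / 2) * (5 ^ k * Real.exp (y / 4)) := by
        gcongr; exact abs_laguerre_le k hy
    _ = 5 ^ k * Real.exp (-y / 2 + y / 4) := by rw [Real.exp_add]; ring
    _ = _ := by congr 2; ring

theorem laguerreFun_sq_le (k : ℕ) {y : ℝ} (hy : 0 ≤ y) :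
    laguerreFun k y ^ 2 ≤ 25 ^ k * Real.exp (-(y / 2)) := by
  calc laguerreFun k y ^ 2 = |laguerreFun k y| ^ 2 := (sq_abs _).symm
    _ ≤ (5 ^ k * Real.exp (-(y / 4))) ^ 2 := by gcongr; exact abs_laguerreFun_le k hy
    _ = _ := by
      rw [mul_pow, ← pow_mul, mul_comm k 2, pow_mul, ← Real.exp_nat_mul]
      norm_num
      ring

theorem integrableOn_pow_mul_exp_neg (n : ℕ) :
    IntegrableOn (fun y : ℝ => y ^ n * Real.exp (-y)) (Ioi 0) := by
  have := Real.GammaIntegral_convergent (s := n + 1) (by positivity)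
  simpa [mul_comm] using this

theorem integral_pow_mul_exp_neg (n : ℕ) :
    ∫ y in Ioi (0 : ℝ), y ^ n * Real.exp (-y) = n.factorial := by
  rw [← Real.Gamma_nat_eq_factorial, Real.Gamma_eq_integral (by positivity)]
  simp [mul_comm]

theorem laguerreFun_sq_eq (k : ℕ) (y : ℝ) :
    laguerreFun k y ^ 2 = ∑ i ∈ Finset.range (k + 1), ∑ j ∈ Finset.range (k + 1),
      ((-1) ^ i * (k.choose i : ℝ) / (i.factorial : ℝ)) *
        ((-1) ^ j * (k.choose j : ℝ) / (j.factorial : ℝ)) * (y ^ (i + j) * Real.exp (-y)) := by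
  rw [laguerreFun, mul_pow, ← Real.exp_nat_mul, sq (laguerre k y), laguerre, Finset.sum_mul_sum,
    Finset.mul_sum]
  refine Finset.sum_congr rfl fun i _ => ?_
  rw [Finset.mul_sum]
  refine Finset.sum_congr rfl fun j _ => ?_
  rw [show ((2 : ℕ) : ℝ) * (-y / 2) = -y by push_cast; ring, pow_add]
  ring

theorem integrableOn_laguerreFun_sq (k : ℕ) :
    IntegrableOn (fun y => laguerreFun k y ^ 2) (Ioi 0) := by
  simp_rw [laguerreFun_sq_eq]
  exact integrable_finsetSum _ fun i _ => integrable_finsetSum _ fun j _ =>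
    (integrableOn_pow_mul_exp_neg _).const_mul _

/-- The Laguerre functions have norm `1` in `L²(ℝ₊)`. -/
theorem integral_laguerreFun_sq (k : ℕ) : ∫ y in Ioi (0 : ℝ), laguerreFun k y ^ 2 = 1 := by
  simp_rw [laguerreFun_sq_eq]
  rw [integral_finsetSum _ fun i _ => integrable_finsetSum _ fun j _ =>
    (integrableOn_pow_mul_exp_neg _).const_mul _]
  have : ∀ i ∈ Finset.range (k + 1), (∫ y in Ioi (0 : ℝ), ∑ j ∈ Finset.range (k + 1),
      ((-1) ^ i * (k.choose i : ℝ) / (i.factorial : ℝ)) *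
        ((-1) ^ j * (k.choose j : ℝ) / (j.factorial : ℝ)) * (y ^ (i + j) * Real.exp (-y))) =
      if i = k then 1 else 0 := fun i hi => by
    rw [integral_finsetSum _ fun j _ => (integrableOn_pow_mul_exp_neg _).const_mul _]
    simp_rw [integral_const_mul, integral_pow_mul_exp_neg]
    have h := congrArg (fun z : ℤ => (-1) ^ i * (k.choose i : ℝ) * (z : ℝ))
      (sum_neg_one_pow_mul_choose_mul_choose_add (Nat.lt_succ_iff.mp (Finset.mem_range.mp hi)))
    simp only [Int.cast_sum, Finset.mul_sum] at h
    calc _ = _ := Finset.sum_congr rfl fun j _ => ?_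
      _ = _ := h
      _ = _ := ?_
    · push_cast
      rw [Nat.cast_add_choose]
      ring
    · split_ifs with hik
      · subst hik
        simp [← mul_pow]
      · simp
  rw [Finset.sum_congr rfl this]
  simp

/-! ### The wavelet transform on the Fourier side -/

theorem psiHat_of_pos (k : ℕ) {ξ : ℝ} (hξ : 0 < ξ) :
    psiHat k ξ = ((Real.sqrt (2 * ξ) * laguerreFun k (2 * ξ) : ℝ) : ℂ) :=
  indicator_of_mem (mem_Ioi.mpr hξ) _

theorem psiHat_of_nonpos (k : ℕ) {ξ : ℝ} (hξ : ξ ≤ 0) : psiHat k ξ = 0 :=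
  indicator_of_notMem (by simpa using hξ) _

theorem measurable_psiHat (k : ℕ) : Measurable (psiHat k) := by
  have := continuous_laguerreFun k
  exact Measurable.indicator (by fun_prop) measurableSet_Ioi

theorem conj_psiHat (k : ℕ) (ξ : ℝ) : starRingEnd ℂ (psiHat k ξ) = psiHat k ξ := by
  rcases le_or_gt ξ 0 with h | h
  · simp [psiHat_of_nonpos k h]
  · rw [psiHat_of_pos k h, Complex.conj_ofReal]

theorem norm_psiHat_le (k : ℕ) {ξ : ℝ} (hξ : 0 < ξ) :
    ‖psiHat k ξ‖ ≤ 2 * 5 ^ k * Real.exp (-(1 / 4) * ξ) := by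
  rw [psiHat_of_pos k hξ, Complex.norm_real, Real.norm_eq_abs, abs_mul,
    abs_of_nonneg (Real.sqrt_nonneg _)]
  -- `2ξ ≤ 4 e^{ξ/2}`, so half of the decay `e^{-ξ/2}` of the Laguerre function absorbs the root
  have h1 : Real.sqrt (2 * ξ) ≤ 2 * Real.exp (ξ / 4) := by
    refine Real.sqrt_le_iff.mpr ⟨by positivity, ?_⟩
    have h := Real.add_one_le_exp (ξ / 2)
    rw [mul_pow, ← Real.exp_nat_mul]
    have : ((2 : ℕ) : ℝ) * (ξ / 4) = ξ / 2 := by push_cast; ring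
    rw [this]
    linarith
  calc _ ≤ (2 * Real.exp (ξ / 4)) * (5 ^ k * Real.exp (-(2 * ξ / 4))) := by
        gcongr
        exact abs_laguerreFun_le k (by positivity)
    _ = 2 * 5 ^ k * Real.exp (ξ / 4 + -(2 * ξ / 4)) := by rw [Real.exp_add]; ring
    _ = _ := by congr 2; ring

theorem norm_psiHat_le_const (k : ℕ) (ξ : ℝ) : ‖psiHat k ξ‖ ≤ 2 * 5 ^ k := by
  rcases le_or_gt ξ 0 with h | h
  · rw [psiHat_of_nonpos k h, norm_zero]; positivity
  · refine (norm_psiHat_le k h).trans (mul_le_of_le_one_right (by positivity) ?_)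
    exact Real.exp_le_one_iff.mpr (by linarith)

theorem integrable_psiHat (k : ℕ) : Integrable (psiHat k) := by
  have h : IntegrableOn (psiHat k) (Ioi 0) := by
    refine Integrable.mono' ((integrableOn_exp_mul_Ioi (a := -(1 / 4)) (by norm_num) 0).const_mul
      (2 * 5 ^ k)) (measurable_psiHat k).aestronglyMeasurable ?_
    filter_upwards [ae_restrict_mem measurableSet_Ioi] with ξ hξ
    exact norm_psiHat_le k hξ
  refine h.integrable_of_forall_notMem_eq_zero fun ξ hξ => psiHat_of_nonpos k (by simpa using hξ)

/-- The Fourier transform `√v ψ̂(v ξ)` of the dilated wavelet `ψ_v`. -/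
def dilatedPsiHat (k : ℕ) (v ξ : ℝ) : ℂ := (Real.sqrt v : ℂ) * psiHat k (v * ξ)

theorem measurable_dilatedPsiHat (k : ℕ) :
    Measurable fun p : ℝ × ℝ => dilatedPsiHat k p.1 p.2 := by
  have := measurable_psiHat k
  unfold dilatedPsiHat
  fun_prop

theorem integrable_dilatedPsiHat (k : ℕ) {v : ℝ} (hv : 0 < v) : Integrable (dilatedPsiHat k v) :=
  ((integrable_psiHat k).comp_mul_left' hv.ne').const_mul _

theorem norm_dilatedPsiHat_le (k : ℕ) (v ξ : ℝ) :
    ‖dilatedPsiHat k v ξ‖ ≤ Real.sqrt v * (2 * 5 ^ k) := by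
  rw [dilatedPsiHat, norm_mul, Complex.norm_real, Real.norm_of_nonneg (Real.sqrt_nonneg v)]
  gcongr
  exact norm_psiHat_le_const k _

theorem memLp_dilatedPsiHat (k : ℕ) {v : ℝ} (hv : 0 < v) : MemLp (dilatedPsiHat k v) 2 := by
  refine (memLp_two_iff_integrable_sq_norm (integrable_dilatedPsiHat k hv).1).mpr ?_
  simp_rw [sq]
  refine (integrable_dilatedPsiHat k hv).norm.bdd_mul (c := Real.sqrt v * (2 * 5 ^ k))
    (integrable_dilatedPsiHat k hv).1.norm ?_
  exact .of_forall fun ξ => by simpa using norm_dilatedPsiHat_le k v ξ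

theorem dilatedPsiHat_of_nonpos (k : ℕ) {v ξ : ℝ} (hv : 0 < v) (hξ : ξ ≤ 0) :
    dilatedPsiHat k v ξ = 0 := by
  rw [dilatedPsiHat, psiHat_of_nonpos k (mul_nonpos_of_nonneg_of_nonpos hv.le hξ), mul_zero]

/-- For fixed `ξ > 0`, the density in `v` of a probability measure on `ℝ₊`. -/
def laguerreKernel (k : ℕ) (ξ v : ℝ) : ℝ := 2 * ξ * laguerreFun k (2 * ξ * v) ^ 2

theorem norm_dilatedPsiHat_sq (k : ℕ) {v ξ : ℝ} (hv : 0 < v) (hξ : 0 < ξ) :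
    ‖dilatedPsiHat k v ξ‖ ^ 2 = v ^ 2 * laguerreKernel k ξ v := by
  rw [laguerreKernel, dilatedPsiHat, psiHat_of_pos k (mul_pos hv hξ), norm_mul, Complex.norm_real,
    Complex.norm_real, Real.norm_eq_abs, Real.norm_eq_abs, mul_pow, sq_abs, sq_abs, mul_pow,
    Real.sq_sqrt hv.le, Real.sq_sqrt (by positivity), show 2 * (v * ξ) = 2 * ξ * v by ring]
  ring

/-- The function on `G` whose Fourier transform in the first variable is `ψ̂_v g`. As `ψ̂_v` vanishes
on `(-∞, 0]`, only the restriction of `g` to `ℝ₊` matters. -/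
def synthesis (k : ℕ) (g : ℝ → ℂ) (p : ℝ × ℝ) : ℂ :=
  𝓕⁻ (fun ξ => dilatedPsiHat k p.2 ξ * g ξ) p.1

theorem synthesis_congr (k : ℕ) {g g' : ℝ → ℂ} (h : g =ᵐ[halfLine] g') {p : ℝ × ℝ}
    (hp : 0 < p.2) : synthesis k g p = synthesis k g' p := by
  refine Real.fourierInv_congr_ae ?_ p.1
  filter_upwards [(ae_restrict_iff' measurableSet_Ioi).mp h] with ξ hξ
  rcases le_or_gt ξ 0 with h0 | h0
  · simp only [dilatedPsiHat_of_nonpos k hp h0, zero_mul]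
  · rw [hξ h0]

/-- The dilated, reflected and translated wavelet as an inverse Fourier transform. -/
theorem conj_dilate_psi_ae_eq (k : ℕ) (u : ℝ) {v : ℝ} (hv : 0 < v) :
    (fun t => starRingEnd ℂ (dilate v (psi k) (u - t))) =ᵐ[volume]
      𝓕⁻ fun ξ : ℝ => Complex.exp (-(2 * Real.pi * (u * ξ) * Complex.I)) * dilatedPsiHat k v ξ := by
  have h1 : (psi k : ℝ → ℂ) =ᵐ[volume] 𝓕⁻ (psiHat k) :=
    fourierInv_toLp_ae_eq (integrable_psiHat k) (memLp_psiHat k)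
  have hq : Measure.QuasiMeasurePreserving (fun t : ℝ => (u - t) / v) volume volume := by
    have h2 : Measure.QuasiMeasurePreserving (fun t : ℝ => t / v) volume volume := by
      refine ⟨by fun_prop, ?_⟩
      simp_rw [div_eq_mul_inv]
      rw [Real.map_volume_mul_right (inv_ne_zero hv.ne')]
      exact Measure.smul_absolutelyContinuous
    exact h2.comp (Measure.measurePreserving_sub_left volume u).quasiMeasurePreserving
  filter_upwards [hq.ae h1] with t ht
  rw [dilate, ht, Real.fourierInv_eq', Real.fourierInv_eq', map_mul, ← integral_conj,
    Complex.conj_ofReal]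
  have e := Measure.integral_comp_mul_left (fun η : ℝ =>
    starRingEnd ℂ (Complex.exp ((2 * Real.pi * inner ℝ η ((u - t) / v) : ℝ) * Complex.I) •
      psiHat k η)) v
  rw [abs_of_pos (inv_pos.mpr hv), eq_inv_smul_iff₀ hv.ne'] at e
  rw [← e, Complex.real_smul, ← mul_assoc, ← integral_const_mul]
  refine integral_congr_ae (.of_forall fun ξ => ?_)
  simp only [smul_eq_mul, map_mul, conj_psiHat, ← Complex.exp_conj, Complex.conj_I,
    Complex.conj_ofReal, dilatedPsiHat]
  have hs : (((Real.sqrt v)⁻¹ : ℝ) : ℂ) * (v : ℂ) = Real.sqrt v := by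
    rw [← Complex.ofReal_mul, inv_mul_eq_div, Real.div_sqrt]
  have hexp : Complex.exp (((2 * Real.pi * inner ℝ (v * ξ) ((u - t) / v) : ℝ) : ℂ) * -Complex.I) =
      Complex.exp (((2 * Real.pi * inner ℝ ξ t : ℝ) : ℂ) * Complex.I) *
        Complex.exp (-(2 * Real.pi * (u * ξ) * Complex.I)) := by
    have hv' : (v : ℂ) ≠ 0 := Complex.ofReal_ne_zero.mpr hv.ne'
    rw [← Complex.exp_add]
    congr 1
    simp only [RCLike.inner_apply, conj_trivial]
    push_cast
    field_simp
    ring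
  rw [hs, hexp]
  ring

/-- On the Fourier side the wavelet transform is the multiplication by `ψ̂_v`. As `ψ_v` is only
square integrable, this is Parseval's identity for `f` and the function
`t ↦ conj (ψ_v (u - t))` rather than the convolution theorem; it holds at every point `(u, v)`. -/
theorem waveletTransform_eq_synthesis (k : ℕ) (f : Lp ℂ 2 (volume : Measure ℝ)) {p : ℝ × ℝ}
    (hp : 0 < p.2) :
    waveletTransform k f p = synthesis k (𝓕 f : Lp ℂ 2 (volume : Measure ℝ)) p := by
  obtain ⟨u, v⟩ := p
  change 0 < v at hp
  set q : ℝ → ℂ := fun ξ =>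
    Complex.exp (-(2 * Real.pi * (u * ξ) * Complex.I)) * dilatedPsiHat k v ξ with hq
  have hnorm : ∀ ξ : ℝ, ‖Complex.exp (-(2 * Real.pi * (u * ξ) * Complex.I))‖ = 1 := fun ξ => by
    rw [← neg_mul]
    exact_mod_cast Complex.norm_exp_ofReal_mul_I (-(2 * Real.pi * (u * ξ)))
  have q1 : Integrable q := (integrable_dilatedPsiHat k hp).bdd_mul (c := 1)
    (by fun_prop) (.of_forall fun ξ => (hnorm ξ).le)
  have q2 : MemLp q 2 := (memLp_dilatedPsiHat k hp).of_le q1.1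
    (.of_forall fun ξ => by rw [hq]; simp only [norm_mul, hnorm, one_mul, le_refl])
  have hin := (Lp.fourierTransformₗᵢ ℝ ℂ).inner_map_map (𝓕⁻ (q2.toLp q)) f
  rw [L2.inner_def, L2.inner_def] at hin
  have e1 : ∫ t, inner ℂ ((𝓕⁻ (q2.toLp q) : Lp ℂ 2 (volume : Measure ℝ)) t) (f t) =
      waveletTransform k f (u, v) := by
    rw [waveletTransform, convolution_def]
    refine integral_congr_ae ?_
    filter_upwards [fourierInv_toLp_ae_eq q1 q2, conj_dilate_psi_ae_eq k u hp] with t h1 h2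
    rw [h1, ← h2]
    simp [mul_comm]
  have e2 : Lp.fourierTransformₗᵢ ℝ ℂ (𝓕⁻ (q2.toLp q)) = q2.toLp q :=
    (Lp.fourierTransformₗᵢ ℝ ℂ).apply_symm_apply _
  rw [← e1, ← hin, e2, synthesis, Real.fourierInv_eq']
  refine integral_congr_ae ?_
  filter_upwards [q2.coeFn_toLp] with ξ hξ
  rw [hξ, show Lp.fourierTransformₗᵢ ℝ ℂ f = 𝓕 f from rfl]
  simp only [hq, RCLike.inner_apply, map_mul, map_neg, map_ofNat, dilatedPsiHat,
    Complex.conj_ofReal, Complex.conj_I, conj_psiHat, ← Complex.exp_conj, smul_eq_mul,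
    conj_trivial]
  push_cast
  ring_nf

/-! ### Plancherel's theorem for the wavelet transform -/

theorem continuous_laguerreKernel (k : ℕ) :
    Continuous fun p : ℝ × ℝ => laguerreKernel k p.1 p.2 := by
  have := continuous_laguerreFun k
  unfold laguerreKernel
  fun_prop

theorem laguerreKernel_nonneg (k : ℕ) {ξ : ℝ} (hξ : 0 < ξ) (v : ℝ) : 0 ≤ laguerreKernel k ξ v := by
  unfold laguerreKernel
  positivity

theorem integrableOn_laguerreKernel (k : ℕ) {ξ : ℝ} (hξ : 0 < ξ) :
    IntegrableOn (laguerreKernel k ξ) (Ioi 0) := by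
  have h := (integrableOn_Ioi_comp_mul_left_iff (fun y => laguerreFun k y ^ 2) 0
    (by positivity : 0 < 2 * ξ)).mpr (by simpa using integrableOn_laguerreFun_sq k)
  exact h.const_mul _

theorem integral_laguerreKernel (k : ℕ) {ξ : ℝ} (hξ : 0 < ξ) :
    ∫ v in Ioi (0 : ℝ), laguerreKernel k ξ v = 1 := by
  have h := integral_comp_mul_left_Ioi (fun y => laguerreFun k y ^ 2) 0
    (by positivity : 0 < 2 * ξ)
  unfold laguerreKernel
  rw [integral_const_mul, h, mul_zero, integral_laguerreFun_sq]
  rw [smul_eq_mul, mul_one, mul_inv_cancel₀ (by positivity)]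

/-- The function `γ_a` for which `T_a^{(k)}` is unitarily equivalent to the multiplication by `γ_a`
on `L²(ℝ₊)`. -/
def spectralFunction (k : ℕ) (a : ℝ → ℂ) (ξ : ℝ) : ℂ :=
  ∫ v in Ioi (0 : ℝ), a v * laguerreKernel k ξ v

section Synthesis

variable (k : ℕ) {g : ℝ → ℂ}

theorem dilatedPsiHat_mul_eq {v : ℝ} (hv : 0 < v) :
    (fun ξ => dilatedPsiHat k v ξ * g ξ) =
      fun ξ => dilatedPsiHat k v ξ * (Ioi 0).indicator g ξ := by
  ext ξ
  rcases le_or_gt ξ 0 with h0 | h0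
  · simp only [dilatedPsiHat_of_nonpos k hv h0, zero_mul]
  · rw [indicator_of_mem (mem_Ioi.mpr h0)]

theorem integrable_dilatedPsiHat_mul (hg : MemLp g 2 halfLine) {v : ℝ} (hv : 0 < v) :
    Integrable fun ξ => dilatedPsiHat k v ξ * g ξ := by
  rw [dilatedPsiHat_mul_eq k hv]
  exact (memLp_dilatedPsiHat k hv).integrable_mul
    ((memLp_indicator_iff_restrict measurableSet_Ioi).mpr hg)

theorem memLp_dilatedPsiHat_mul (hg : MemLp g 2 halfLine) {v : ℝ} (hv : 0 < v) :
    MemLp (fun ξ => dilatedPsiHat k v ξ * g ξ) 2 := by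
  rw [dilatedPsiHat_mul_eq k hv]
  exact ((memLp_indicator_iff_restrict measurableSet_Ioi).mpr hg).mul
    (memLp_top_of_bound (integrable_dilatedPsiHat k hv).1 _
      (.of_forall (norm_dilatedPsiHat_le k v)))

theorem memLp_synthesis_slice (hg : MemLp g 2 halfLine) {v : ℝ} (hv : 0 < v) :
    MemLp (fun u => synthesis k g (u, v)) 2 :=
  memLp_fourierInv (integrable_dilatedPsiHat_mul k hg hv) (memLp_dilatedPsiHat_mul k hg hv)

theorem integral_norm_synthesis_slice_sq (hg : MemLp g 2 halfLine) {v : ℝ} (hv : 0 < v) :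
    ∫ u, ‖synthesis k g (u, v)‖ ^ 2 =
      v ^ 2 * ∫ ξ in Ioi (0 : ℝ), laguerreKernel k ξ v * ‖g ξ‖ ^ 2 := by
  refine (integral_norm_fourierInv_sq (integrable_dilatedPsiHat_mul k hg hv)
    (memLp_dilatedPsiHat_mul k hg hv)).trans ?_
  rw [← integral_const_mul, ← setIntegral_eq_integral_of_forall_compl_eq_zero (s := Ioi 0)]
  · refine setIntegral_congr_fun measurableSet_Ioi fun ξ hξ => ?_
    simp only [norm_mul, mul_pow, norm_dilatedPsiHat_sq k hv hξ]
    ring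
  · intro ξ hξ
    simp [dilatedPsiHat_of_nonpos k hv (by simpa using hξ)]

theorem stronglyMeasurable_synthesis (hg : Measurable g) :
    StronglyMeasurable (synthesis k g) := by
  have : synthesis k g = fun p : ℝ × ℝ =>
      ∫ ξ, Complex.exp ((2 * Real.pi * inner ℝ ξ p.1 : ℝ) * Complex.I) •
        (dilatedPsiHat k p.2 ξ * g ξ) := by
    ext p
    exact Real.fourierInv_eq' _ _
  rw [this]
  have h1 : Measurable fun q : (ℝ × ℝ) × ℝ => dilatedPsiHat k q.1.2 q.2 :=
    (measurable_dilatedPsiHat k).comp (by fun_prop : Measurable fun q : (ℝ × ℝ) × ℝ => (q.1.2, q.2))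
  have h2 : Measurable fun q : (ℝ × ℝ) × ℝ =>
      Complex.exp ((2 * Real.pi * inner ℝ q.2 q.1.1 : ℝ) * Complex.I) •
        (dilatedPsiHat k q.1.2 q.2 * g q.2) := by
    have h3 : Continuous fun q : (ℝ × ℝ) × ℝ =>
        Complex.exp ((2 * Real.pi * inner ℝ q.2 q.1.1 : ℝ) * Complex.I) := by fun_prop
    exact h3.measurable.smul (h1.mul (hg.comp measurable_snd))
  exact h2.stronglyMeasurable.integral_prod_right'

theorem integrable_laguerreKernel_mul (hg : MemLp g 2 halfLine) :
    Integrable (fun p : ℝ × ℝ => laguerreKernel k p.2 p.1 * ‖g p.2‖ ^ 2)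
      (halfLine.prod halfLine) := by
  have hm : AEStronglyMeasurable (fun p : ℝ × ℝ => laguerreKernel k p.2 p.1 * ‖g p.2‖ ^ 2)
      (halfLine.prod halfLine) :=
    (((continuous_laguerreKernel k).comp continuous_swap).aestronglyMeasurable).mul
      ((hg.1.comp_snd).norm.pow 2)
  refine (integrable_prod_iff' hm).mpr ⟨?_, ?_⟩
  · filter_upwards [ae_restrict_mem measurableSet_Ioi] with ξ hξ
    exact (integrableOn_laguerreKernel k hξ).mul_const _
  · refine ((memLp_two_iff_integrable_sq_norm hg.1).mp hg).congr ?_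
    filter_upwards [ae_restrict_mem measurableSet_Ioi] with ξ hξ
    have : ∀ v, ‖laguerreKernel k ξ v * ‖g ξ‖ ^ 2‖ = laguerreKernel k ξ v * ‖g ξ‖ ^ 2 := fun v =>
      Real.norm_of_nonneg (mul_nonneg (laguerreKernel_nonneg k hξ v) (by positivity))
    simp only [this]
    rw [integral_mul_const, integral_laguerreKernel k hξ, one_mul]

theorem integral_affineHaar_snd {f : ℝ × ℝ → ℂ} (hf : Integrable f affineHaar) :
    ∫ p, f p ∂affineHaar = ∫ v in Ioi (0 : ℝ), ((v ^ 2)⁻¹ : ℝ) * ∫ u, f (u, v) := by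
  rw [affineHaar] at hf ⊢
  rw [integral_prod_symm _ hf, integral_withDensity_eq_integral_toReal_smul (by fun_prop)
    (by simp)]
  refine integral_congr_ae (.of_forall fun v => ?_)
  simp only
  rw [ENNReal.toReal_ofReal (by positivity), Complex.real_smul]

theorem memLp_synthesis (hm : Measurable g) (hg : MemLp g 2 halfLine) :
    MemLp (synthesis k g) 2 affineHaar := by
  have hs := (stronglyMeasurable_synthesis k hm).aestronglyMeasurable (μ := affineHaar)
  refine (memLp_two_iff_integrable_sq_norm hs).mpr ?_
  refine (integrable_prod_iff' (hs.norm.pow 2)).mpr ⟨?_, ?_⟩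
  · filter_upwards [(withDensity_absolutelyContinuous _ _).ae_le
      (ae_restrict_mem measurableSet_Ioi)] with v hv
    exact (memLp_two_iff_integrable_sq_norm (memLp_synthesis_slice k hg hv).1).mp
      (memLp_synthesis_slice k hg hv)
  · rw [integrable_withDensity_iff_integrable_smul' (by fun_prop) (by simp)]
    refine (integrable_laguerreKernel_mul k hg).integral_prod_left.congr ?_
    filter_upwards [ae_restrict_mem measurableSet_Ioi] with v hv
    have hv' : v ≠ 0 := (mem_Ioi.mp hv).ne'
    have e : ∀ u : ℝ, ‖(‖synthesis k g (u, v)‖ ^ 2 : ℝ)‖ = ‖synthesis k g (u, v)‖ ^ 2 := fun u =>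
      Real.norm_of_nonneg (by positivity)
    simp only [Pi.pow_apply, e]
    rw [integral_norm_synthesis_slice_sq k hg hv, ENNReal.toReal_ofReal (by positivity),
      smul_eq_mul, ← mul_assoc, inv_mul_cancel₀ (by positivity), one_mul]

/-- Integration against a symbol `a(v)` of the squared modulus of a wavelet transform amounts to
integration of `γ_a` against the squared modulus of the Fourier transform. -/
theorem integral_mul_norm_synthesis_sq (hm : Measurable g) (hg : MemLp g 2 halfLine) {a : ℝ → ℂ}
    (ha : MemLp a ∞ halfLine) :
    ∫ p, a p.2 * (‖synthesis k g p‖ ^ 2 : ℝ) ∂affineHaar =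
      ∫ ξ in Ioi (0 : ℝ), spectralFunction k a ξ * (‖g ξ‖ ^ 2 : ℝ) := by
  have hs := memLp_synthesis k hm hg
  have hs2 := (memLp_two_iff_integrable_sq_norm hs.1).mp hs
  have hint' : Integrable (fun p : ℝ × ℝ => a p.2 * ((‖synthesis k g p‖ ^ 2 : ℝ) : ℂ))
      affineHaar := Integrable.mul_of_top_right hs2.ofReal (memLp_vertical ha)
  rw [integral_affineHaar_snd hint']
  have hint : Integrable (Function.uncurry fun v ξ : ℝ =>
      a v * ((laguerreKernel k ξ v * ‖g ξ‖ ^ 2 : ℝ) : ℂ)) (halfLine.prod halfLine) := by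
    refine Integrable.bdd_mul (c := (eLpNorm a ∞ halfLine).toReal)
      (integrable_laguerreKernel_mul k hg).ofReal ha.1.comp_fst ?_
    exact Measure.quasiMeasurePreserving_fst.ae (ae_norm_le_of_memLp_top ha)
  calc _ = ∫ v in Ioi (0 : ℝ), ∫ ξ in Ioi (0 : ℝ),
        a v * ((laguerreKernel k ξ v * ‖g ξ‖ ^ 2 : ℝ) : ℂ) := by
        refine setIntegral_congr_fun measurableSet_Ioi fun v hv => ?_
        have hv' : (v : ℂ) ≠ 0 := Complex.ofReal_ne_zero.mpr (mem_Ioi.mp hv).ne'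
        simp only
        rw [integral_const_mul, integral_const_mul, integral_complex_ofReal,
          integral_complex_ofReal, integral_norm_synthesis_slice_sq k hg hv]
        push_cast
        field_simp
    _ = ∫ ξ in Ioi (0 : ℝ), ∫ v in Ioi (0 : ℝ),
        a v * ((laguerreKernel k ξ v * ‖g ξ‖ ^ 2 : ℝ) : ℂ) := integral_integral_swap hint
    _ = _ := by
        refine integral_congr_ae (.of_forall fun ξ => ?_)
        simp only [spectralFunction, Complex.ofReal_mul, ← mul_assoc]
        rw [integral_mul_const]

end Synthesis

/-! ### Continuity and limits of `γ_a` -/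

/-- A function with an essential limit agrees almost everywhere with one that has a limit. -/
theorem exists_ae_eq_tendsto {α : Type*} {_ : MeasurableSpace α} {μ : Measure α} {m : Filter α}
    {a : α → ℂ} {L : ℂ} (h : Tendsto a (ae μ ⊓ m) (𝓝 L)) :
    ∃ a' : α → ℂ, a' =ᵐ[μ] a ∧ Tendsto a' m (𝓝 L) := by
  classical
  obtain ⟨U, hU⟩ := (𝓝 L).exists_antitone_basis
  have h1 : ∀ n, ∃ s ∈ ae μ, ∃ t ∈ m, ∀ v ∈ s ∩ t, a v ∈ U n := fun n => by
    obtain ⟨s, hs, t, ht, hst⟩ := mem_inf_iff_superset.mp (h (hU.mem n))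
    exact ⟨s, hs, t, ht, fun v hv => hst hv⟩
  choose s hs t ht hst using h1
  -- on the null set of the `v` outside some `s n` the value is replaced by the limit
  refine ⟨fun v => if ∀ n, v ∈ s n then a v else L, ?_, ?_⟩
  · filter_upwards [ae_all_iff.mpr hs] with v hv
    exact if_pos hv
  · refine hU.tendsto_right_iff.mpr fun n _ => ?_
    filter_upwards [ht n] with v hv
    split_ifs with hsv
    · exact hst n v ⟨hsv n, hv⟩
    · exact mem_of_mem_nhds (hU.mem n)

theorem spectralFunction_congr (k : ℕ) {a a' : ℝ → ℂ} (h : a =ᵐ[halfLine] a') :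
    spectralFunction k a = spectralFunction k a' := by
  ext ξ
  exact integral_congr_ae (h.mono fun v hv => by simp only [hv])

theorem quasiMeasurePreserving_mul_halfLine {c : ℝ} (hc : 0 < c) :
    Measure.QuasiMeasurePreserving (fun y => y * c) halfLine halfLine := by
  have h2 : Measure.QuasiMeasurePreserving (fun t : ℝ => t * c) volume volume := by
    refine ⟨by fun_prop, ?_⟩
    rw [Real.map_volume_mul_right hc.ne']
    exact Measure.smul_absolutelyContinuous
  exact h2.restrict fun y hy => mul_pos hy hc

theorem spectralFunction_eq (k : ℕ) (a : ℝ → ℂ) {ξ : ℝ} (hξ : 0 < ξ) :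
    spectralFunction k a ξ =
      ∫ y in Ioi (0 : ℝ), a (y * (2 * ξ)⁻¹) * ((laguerreFun k y ^ 2 : ℝ) : ℂ) := by
  have h2 : 0 < 2 * ξ := by positivity
  have h := integral_comp_mul_left_Ioi
    (fun y => a (y * (2 * ξ)⁻¹) * ((laguerreFun k y ^ 2 : ℝ) : ℂ)) 0 h2
  rw [mul_zero, eq_inv_smul_iff₀ h2.ne'] at h
  rw [← h, spectralFunction, Complex.real_smul, ← integral_const_mul]
  refine integral_congr_ae (.of_forall fun v => ?_)
  simp only [laguerreKernel]
  rw [mul_comm (2 * ξ) v, mul_inv_cancel_right₀ h2.ne']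
  push_cast
  ring

/-- Limits of `γ_a`: as `γ_a(ξ)` is the mean of `y ↦ a(y / 2ξ)` with respect to the probability
density `ℓ_k²`, the essential limits of `a` carry over to `γ_a`. -/
theorem tendsto_spectralFunction (k : ℕ) {a : ℝ → ℂ} (ha : MemLp a ∞ halfLine) {l m : Filter ℝ}
    [l.IsCountablyGenerated] (hl : ∀ᶠ ξ in l, 0 < ξ)
    (hlm : ∀ y, 0 < y → Tendsto (fun ξ => y * (2 * ξ)⁻¹) l m) {L : ℂ}
    (hL : Tendsto a (ae halfLine ⊓ m) (𝓝 L)) : Tendsto (spectralFunction k a) l (𝓝 L) := by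
  -- dominated convergence needs a limit of `a (y / 2ξ)` for fixed `y`, hence a genuine limit of `a`
  obtain ⟨a', haa', hL'⟩ := exists_ae_eq_tendsto hL
  have ha' : MemLp a' ∞ halfLine := (memLp_congr_ae haa').mpr ha
  rw [← spectralFunction_congr k haa']
  have hlim : ∫ y in Ioi (0 : ℝ), L * ((laguerreFun k y ^ 2 : ℝ) : ℂ) = L := by
    rw [integral_const_mul, integral_complex_ofReal, integral_laguerreFun_sq, Complex.ofReal_one,
      mul_one]
  have hcont := continuous_laguerreFun k
  have key : Tendsto (fun ξ => ∫ y in Ioi (0 : ℝ), a' (y * (2 * ξ)⁻¹) *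
      ((laguerreFun k y ^ 2 : ℝ) : ℂ)) l
      (𝓝 (∫ y in Ioi (0 : ℝ), L * ((laguerreFun k y ^ 2 : ℝ) : ℂ))) := by
    refine tendsto_integral_filter_of_dominated_convergence
      (fun y => (eLpNorm a' ∞ halfLine).toReal * laguerreFun k y ^ 2) ?_ ?_
      ((integrableOn_laguerreFun_sq k).const_mul _) ?_
    · filter_upwards [hl] with ξ hξ
      exact (ha'.1.comp_quasiMeasurePreserving
        (quasiMeasurePreserving_mul_halfLine (by positivity))).mul
        (Continuous.aestronglyMeasurable (by fun_prop))
    · filter_upwards [hl] with ξ hξ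
      filter_upwards [(quasiMeasurePreserving_mul_halfLine (c := (2 * ξ)⁻¹) (by positivity)).ae
        (ae_norm_le_of_memLp_top ha')] with y hy
      rw [norm_mul, Complex.norm_real, Real.norm_of_nonneg (sq_nonneg _)]
      gcongr
    · filter_upwards [ae_restrict_mem measurableSet_Ioi] with y hy
      exact (hL'.comp (hlm y hy)).mul_const _
  rw [hlim] at key
  refine key.congr' ?_
  filter_upwards [hl] with ξ hξ
  exact (spectralFunction_eq k a' hξ).symm

theorem tendsto_spectralFunction_zero (k : ℕ) {a : ℝ → ℂ} (ha : MemLp a ∞ halfLine) {L : ℂ}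
    (hL : Tendsto a (ae halfLine ⊓ atTop) (𝓝 L)) :
    Tendsto (spectralFunction k a) (𝓝[>] 0) (𝓝 L) := by
  refine tendsto_spectralFunction k ha (l := 𝓝[>] 0) self_mem_nhdsWithin (fun y hy => ?_) hL
  refine Tendsto.const_mul_atTop hy (tendsto_inv_nhdsGT_zero.comp ?_)
  refine tendsto_nhdsWithin_iff.mpr ⟨?_, ?_⟩
  · exact ((continuous_const_mul (2 : ℝ)).tendsto' 0 0 (by simp)).mono_left nhdsWithin_le_nhds
  · filter_upwards [eventually_mem_nhdsWithin] with ξ hξ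
    exact mul_pos two_pos (mem_Ioi.mp hξ)

theorem tendsto_spectralFunction_atTop (k : ℕ) {a : ℝ → ℂ} (ha : MemLp a ∞ halfLine) {L : ℂ}
    (hL : Tendsto a (ae halfLine ⊓ 𝓝 0) (𝓝 L)) :
    Tendsto (spectralFunction k a) atTop (𝓝 L) := by
  refine tendsto_spectralFunction k ha (eventually_gt_atTop 0) (fun y hy => ?_) hL
  simpa using (tendsto_inv_atTop_zero.comp (tendsto_id.const_mul_atTop two_pos)).const_mul y

theorem continuousOn_spectralFunction (k : ℕ) {a : ℝ → ℂ} (ha : MemLp a ∞ halfLine) :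
    ContinuousOn (spectralFunction k a) (Ioi 0) := by
  intro ξ₀ hξ₀
  have hξ₀' : 0 < ξ₀ := hξ₀
  refine ContinuousAt.continuousWithinAt ?_
  have hcont := continuous_laguerreKernel k
  refine continuousAt_of_dominated (bound := fun v => (eLpNorm a ∞ halfLine).toReal *
    (2 * (2 * ξ₀) * (25 ^ k * Real.exp (-(ξ₀ / 2) * v)))) ?_ ?_ ?_ ?_
  · exact .of_forall fun ξ => ha.1.mul (Continuous.aestronglyMeasurable (by fun_prop))
  · filter_upwards [Ioo_mem_nhds (half_lt_self hξ₀') (by linarith : ξ₀ < 2 * ξ₀)] with ξ hξ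
    have hξ0 : 0 < ξ := (half_pos hξ₀').trans hξ.1
    filter_upwards [ae_norm_le_of_memLp_top ha, ae_restrict_mem measurableSet_Ioi] with v hv hv0
    have hv0' : 0 < v := hv0
    rw [norm_mul, Complex.norm_real, Real.norm_of_nonneg (laguerreKernel_nonneg k hξ0 v),
      laguerreKernel]
    gcongr
    · exact hξ.2.le
    · refine (laguerreFun_sq_le k (by positivity)).trans ?_
      gcongr
      nlinarith [hξ.1]
  · exact ((integrableOn_exp_mul_Ioi (a := -(ξ₀ / 2)) (by linarith) 0).const_mul _).const_mul _
      |>.const_mul _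
  · exact .of_forall fun v => Continuous.continuousAt (by fun_prop)

/-! ### The function `∇` and its continuous extension -/

/-- The frequency `ξ > 0` at which `1 - e^{-2λξ} = x`. -/
def frequency (lam x : ℝ) : ℝ := -Real.log (1 - x) / (2 * lam)

theorem frequency_pos {lam x : ℝ} (hlam : 0 < lam) (hx : x ∈ Ioo (0 : ℝ) 1) :
    0 < frequency lam x :=
  div_pos (neg_pos.mpr (Real.log_neg (by linarith [hx.2]) (by linarith [hx.1]))) (by positivity)

theorem nablaIntegrand_eq (a : ℝ → ℂ) {lam : ℝ} (hlam : 0 < lam) (k : ℕ) {x : ℝ}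
    (hx : x ∈ Ioo (0 : ℝ) 1) (v : ℝ) :
    nablaIntegrand a lam k x v =
      a v * ((laguerreFun k (2 * frequency lam x * v) ^ 2 : ℝ) : ℂ) := by
  have h1 : -(v / lam) * Real.log (1 - x) = 2 * frequency lam x * v := by
    unfold frequency; field_simp
  have h2 : (1 - x) ^ (v / lam) = Real.exp (-(2 * frequency lam x * v) / 2) ^ 2 := by
    rw [Real.rpow_def_of_pos (by linarith [hx.2]), ← Real.exp_nat_mul]
    congr 1
    rw [← h1]
    push_cast
    ring
  rw [nablaIntegrand, h1, h2, ← mul_pow, laguerreFun]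

theorem integrableOn_nablaIntegrand {a : ℝ → ℂ} (ha : MemLp a ∞ halfLine) {lam : ℝ}
    (hlam : 0 < lam) (k : ℕ) {x : ℝ} (hx : x ∈ Ioo (0 : ℝ) 1) :
    IntegrableOn (nablaIntegrand a lam k x) (Ioi 0) := by
  have hξ := frequency_pos hlam hx
  have h := (integrableOn_Ioi_comp_mul_left_iff (fun y => laguerreFun k y ^ 2) 0
    (by positivity : 0 < 2 * frequency lam x)).mpr (by simpa using integrableOn_laguerreFun_sq k)
  have : nablaIntegrand a lam k x = fun v =>
      a v * ((laguerreFun k (2 * frequency lam x * v) ^ 2 : ℝ) : ℂ) :=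
    funext (nablaIntegrand_eq a hlam k hx)
  rw [this]
  exact Integrable.mul_of_top_right h.ofReal ha

theorem nabla_eq_spectralFunction (a : ℝ → ℂ) {lam : ℝ} (hlam : 0 < lam) (k : ℕ) {x : ℝ}
    (hx : x ∈ Ioo (0 : ℝ) 1) : nabla a lam k x = spectralFunction k a (frequency lam x) := by
  rw [nabla, spectralFunction, ← integral_const_mul]
  refine integral_congr_ae (.of_forall fun v => ?_)
  simp only [nablaIntegrand_eq a hlam k hx, laguerreKernel]
  have : -(1 / lam) * Real.log (1 - x) = 2 * frequency lam x := by
    unfold frequency; field_simp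
  rw [this]
  push_cast
  ring

/-- The continuous extension of `∇` to `[0, 1]`. -/
theorem exists_continuousOn_extension_nabla (k : ℕ) {lam : ℝ} (hlam : 0 < lam) {a : ℝ → ℂ}
    (ha : MemLp a ∞ halfLine) {a₀ aInf : ℂ} (ha₀ : Tendsto a (ae halfLine ⊓ 𝓝 0) (𝓝 a₀))
    (haInf : Tendsto a (ae halfLine ⊓ atTop) (𝓝 aInf)) :
    ∃ N : ℝ → ℂ, ContinuousOn N (Icc 0 1) ∧ EqOn N (nabla a lam k) (Ioo 0 1) ∧
      N 0 = aInf ∧ N 1 = a₀ := by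
  have hc : ContinuousOn (frequency lam) (Ioo 0 1) := by
    unfold frequency
    refine ContinuousOn.div_const (ContinuousOn.neg (ContinuousOn.log (by fun_prop) ?_)) _
    intro x hx
    linarith [hx.2]
  have hn : ContinuousOn (nabla a lam k) (Ioo 0 1) :=
    ((continuousOn_spectralFunction k ha).comp hc fun x hx => frequency_pos hlam hx).congr
      fun x hx => nabla_eq_spectralFunction a hlam k hx
  have h0 : Tendsto (nabla a lam k) (𝓝[>] 0) (𝓝 aInf) := by
    have hf : Tendsto (frequency lam) (𝓝[>] 0) (𝓝[>] 0) := by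
      refine tendsto_nhdsWithin_iff.mpr ⟨?_, ?_⟩
      · have : ContinuousAt (frequency lam) 0 := by
          unfold frequency
          refine ContinuousAt.div_const (ContinuousAt.neg (ContinuousAt.log (by fun_prop) ?_)) _
          simp
        have h := this.tendsto
        rw [show frequency lam 0 = 0 by simp [frequency]] at h
        exact h.mono_left nhdsWithin_le_nhds
      · filter_upwards [Ioo_mem_nhdsGT (zero_lt_one' ℝ)] with x hx
        exact frequency_pos hlam hx
    refine ((tendsto_spectralFunction_zero k ha haInf).comp hf).congr' ?_
    filter_upwards [Ioo_mem_nhdsGT (zero_lt_one' ℝ)] with x hx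
    exact (nabla_eq_spectralFunction a hlam k hx).symm
  have h1 : Tendsto (nabla a lam k) (𝓝[<] 1) (𝓝 a₀) := by
    have hf : Tendsto (frequency lam) (𝓝[<] 1) atTop := by
      refine Tendsto.atTop_div_const (by positivity) (tendsto_neg_atBot_atTop.comp ?_)
      refine Real.tendsto_log_nhdsGT_zero.comp (tendsto_nhdsWithin_iff.mpr ⟨?_, ?_⟩)
      · exact ((continuous_sub_left (1 : ℝ)).tendsto' 1 0 (by simp)).mono_left nhdsWithin_le_nhds
      · filter_upwards [eventually_mem_nhdsWithin] with x hx
        exact sub_pos.mpr (mem_Iio.mp hx)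
    refine ((tendsto_spectralFunction_atTop k ha ha₀).comp hf).congr' ?_
    filter_upwards [Ioo_mem_nhdsLT (zero_lt_one' ℝ)] with x hx
    exact (nabla_eq_spectralFunction a hlam k hx).symm
  refine ⟨extendFrom (Ioo 0 1) (nabla a lam k),
    continuousOn_Icc_extendFrom_Ioo hn h0 h1, fun x hx => ?_,
    eq_lim_at_left_extendFrom_Ioo zero_lt_one h0, eq_lim_at_right_extendFrom_Ioo zero_lt_one h1⟩
  exact extendFrom_eq (subset_closure hx) (hn x hx)

/-- For `k = 0` and `a = χ_{[0,λ]}` one has `γ_a(ξ) = 1 - e^{-2λξ}`. -/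
theorem spectralFunction_chi {lam : ℝ} (hlam : 0 < lam) (ξ : ℝ) :
    spectralFunction 0 (chi lam) ξ = ((1 - Real.exp (-(2 * lam * ξ)) : ℝ) : ℂ) := by
  have h1 : ∀ v, chi lam v * (laguerreKernel 0 ξ v : ℂ) = (Icc 0 lam).indicator
      (fun v => ((2 * ξ * Real.exp (-(2 * ξ) * v) : ℝ) : ℂ)) v := fun v => by
    by_cases hv : v ∈ Icc 0 lam
    · rw [chi, indicator_of_mem hv, indicator_of_mem hv, one_mul, laguerreKernel, laguerreFun,
        mul_pow, ← Real.exp_nat_mul, show laguerre 0 (2 * ξ * v) = 1 by simp [laguerre], one_pow,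
        mul_one, show ((2 : ℕ) : ℝ) * (-(2 * ξ * v) / 2) = -(2 * ξ) * v by push_cast; ring]
    · rw [chi, indicator_of_notMem hv, indicator_of_notMem hv, zero_mul]
  rw [spectralFunction]
  simp_rw [h1]
  rw [setIntegral_indicator measurableSet_Icc,
    show Ioi (0 : ℝ) ∩ Icc 0 lam = Ioc 0 lam by ext; simp; grind,
    ← intervalIntegral.integral_of_le hlam.le, intervalIntegral.integral_ofReal]
  congr 1
  have hd : ∀ v ∈ uIcc 0 lam, HasDerivAt (fun v => -Real.exp (-(2 * ξ) * v))
      (2 * ξ * Real.exp (-(2 * ξ) * v)) v := fun v _ => by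
    have := (((hasDerivAt_id v).const_mul (-(2 * ξ))).exp).neg
    refine this.congr_deriv ?_
    simp only [id_eq]
    ring
  rw [intervalIntegral.integral_eq_sub_of_hasDerivAt hd
    (Continuous.intervalIntegrable (by fun_prop) _ _)]
  simp
  ring_nf

/-! ### The wavelet subspaces -/

theorem synthesis_add (k : ℕ) {g₁ g₂ : ℝ → ℂ} (h₁ : MemLp g₁ 2 halfLine)
    (h₂ : MemLp g₂ 2 halfLine) {p : ℝ × ℝ} (hp : 0 < p.2) :
    synthesis k (g₁ + g₂) p = synthesis k g₁ p + synthesis k g₂ p := by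
  have hi : ∀ {g : ℝ → ℂ}, MemLp g 2 halfLine → Integrable fun ξ : ℝ =>
      Complex.exp ((2 * Real.pi * inner ℝ ξ p.1 : ℝ) * Complex.I) •
        (dilatedPsiHat k p.2 ξ * g ξ) := fun {g} hg =>
    (integrable_dilatedPsiHat_mul k hg hp).bdd_mul (c := 1) (by fun_prop)
      (.of_forall fun ξ => (Complex.norm_exp_ofReal_mul_I _).le)
  simp only [synthesis, Real.fourierInv_eq']
  rw [← integral_add (hi h₁) (hi h₂)]
  refine integral_congr_ae (.of_forall fun ξ => ?_)
  simp only [Pi.add_apply, smul_eq_mul]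
  ring

theorem synthesis_smul (k : ℕ) (c : ℂ) (g : ℝ → ℂ) (p : ℝ × ℝ) :
    synthesis k (c • g) p = c * synthesis k g p := by
  simp only [synthesis, Real.fourierInv_eq']
  rw [← integral_const_mul]
  refine integral_congr_ae (.of_forall fun ξ => ?_)
  simp only [Pi.smul_apply, smul_eq_mul]
  ring

theorem memLp_synthesis_Lp (k : ℕ) (g : Lp ℂ 2 halfLine) : MemLp (synthesis k g) 2 affineHaar :=
  memLp_synthesis k (Lp.stronglyMeasurable g).measurable (Lp.memLp g)

theorem spectralFunction_one (k : ℕ) {ξ : ℝ} (hξ : 0 < ξ) :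
    spectralFunction k (fun _ => 1) ξ = 1 := by
  simp only [spectralFunction, one_mul]
  rw [integral_complex_ofReal, integral_laguerreKernel k hξ, Complex.ofReal_one]

theorem integral_norm_synthesis_sq (k : ℕ) (g : Lp ℂ 2 halfLine) :
    ∫ p, ‖synthesis k g p‖ ^ 2 ∂affineHaar = ∫ ξ in Ioi (0 : ℝ), ‖g ξ‖ ^ 2 := by
  have h := integral_mul_norm_synthesis_sq k (Lp.stronglyMeasurable g).measurable (Lp.memLp g)
    (memLp_top_const (1 : ℂ))
  have h2 : ∫ ξ in Ioi (0 : ℝ), spectralFunction k (fun _ => 1) ξ * ((‖g ξ‖ ^ 2 : ℝ) : ℂ) =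
      ∫ ξ in Ioi (0 : ℝ), ((‖g ξ‖ ^ 2 : ℝ) : ℂ) :=
    setIntegral_congr_fun measurableSet_Ioi fun ξ hξ => by
      simp only [spectralFunction_one k hξ, one_mul]
  rw [h2] at h
  simp only [one_mul] at h
  rw [integral_complex_ofReal, integral_complex_ofReal] at h
  exact_mod_cast h

/-- The isometry `L²(ℝ₊) → L²(G, dν)` that turns the Fourier transform of `f ∈ H₂⁺(ℝ)` into
`W_k f`. -/
def synthesisIsometry (k : ℕ) : Lp ℂ 2 halfLine →ₗᵢ[ℂ] Lp ℂ 2 affineHaar where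
  toFun g := (memLp_synthesis_Lp k g).toLp
  map_add' g₁ g₂ := by
    rw [← MemLp.toLp_add, MemLp.toLp_eq_toLp_iff]
    filter_upwards [ae_affineHaar_pos] with p hp
    rw [synthesis_congr k (Lp.coeFn_add g₁ g₂) hp,
      synthesis_add k (Lp.memLp g₁) (Lp.memLp g₂) hp, Pi.add_apply]
  map_smul' c g := by
    rw [RingHom.id_apply, ← MemLp.toLp_const_smul, MemLp.toLp_eq_toLp_iff]
    filter_upwards [ae_affineHaar_pos] with p hp
    rw [synthesis_congr k (Lp.coeFn_smul c g) hp, synthesis_smul, Pi.smul_apply, smul_eq_mul]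
  norm_map' g := by
    have h1 : inner ℂ ((memLp_synthesis_Lp k g).toLp) ((memLp_synthesis_Lp k g).toLp) =
        inner ℂ g g := by
      rw [inner_self_eq_integral_norm_sq, inner_self_eq_integral_norm_sq,
        ← integral_norm_synthesis_sq k g]
      congr 1
      exact integral_congr_ae ((memLp_synthesis_Lp k g).coeFn_toLp.mono fun p hp => by
        simp only [hp])
    rw [inner_self_eq_norm_sq_to_K, inner_self_eq_norm_sq_to_K] at h1
    have h2 : ‖(memLp_synthesis_Lp k g).toLp‖ ^ 2 = ‖g‖ ^ 2 := by exact_mod_cast h1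
    exact (sq_eq_sq₀ (norm_nonneg _) (norm_nonneg _)).mp h2

theorem coeFn_synthesisIsometry (k : ℕ) (g : Lp ℂ 2 halfLine) :
    synthesisIsometry k g =ᵐ[affineHaar] synthesis k g :=
  (memLp_synthesis_Lp k g).coeFn_toLp

/-- The restriction of the Fourier transform of `f` to `ℝ₊`. -/
def fourierHalfLine (f : Lp ℂ 2 (volume : Measure ℝ)) : Lp ℂ 2 halfLine :=
  ((Lp.memLp (𝓕 f : Lp ℂ 2 (volume : Measure ℝ))).restrict (Ioi 0)).toLp

theorem synthesisIsometry_fourierHalfLine (k : ℕ) (f : Lp ℂ 2 (volume : Measure ℝ)) :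
    synthesisIsometry k (fourierHalfLine f) =ᵐ[affineHaar] waveletTransform k f := by
  filter_upwards [coeFn_synthesisIsometry k (fourierHalfLine f), ae_affineHaar_pos] with p h1 hp
  rw [h1, waveletTransform_eq_synthesis k f hp]
  exact synthesis_congr k (MemLp.coeFn_toLp _) hp

/-- The restriction of the Fourier transform to `ℝ₊` maps the Hardy space onto `L²(ℝ₊)`. -/
theorem exists_mem_hardySpace_fourierHalfLine_eq (g : Lp ℂ 2 halfLine) :
    ∃ f ∈ hardySpace, fourierHalfLine f = g := by
  have hm : MemLp ((Ioi (0 : ℝ)).indicator g) 2 volume :=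
    (memLp_indicator_iff_restrict measurableSet_Ioi).mpr (Lp.memLp g)
  have hF : (𝓕 (𝓕⁻ hm.toLp : Lp ℂ 2 (volume : Measure ℝ)) : Lp ℂ 2 (volume : Measure ℝ)) =
      hm.toLp := (Lp.fourierTransformₗᵢ ℝ ℂ).apply_symm_apply _
  have hae : (𝓕 (𝓕⁻ hm.toLp : Lp ℂ 2 (volume : Measure ℝ)) : Lp ℂ 2 (volume : Measure ℝ))
      =ᵐ[volume] (Ioi (0 : ℝ)).indicator g := by
    rw [hF]
    exact hm.coeFn_toLp
  refine ⟨𝓕⁻ hm.toLp, ?_, ?_⟩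
  · change ∀ᵐ ξ : ℝ, _
    filter_upwards [hae] with ξ hξ h0
    rw [hξ, indicator_of_notMem (by simpa using h0.le)]
  · refine Lp.ext ((MemLp.coeFn_toLp _).trans ?_)
    filter_upwards [ae_restrict_of_ae hae, ae_restrict_mem measurableSet_Ioi] with ξ h1 h2
    rw [h1, indicator_of_mem h2]

theorem range_synthesisIsometry (k : ℕ) :
    LinearMap.range (synthesisIsometry k).toLinearMap = waveletSubspace k := by
  ext F
  constructor
  · rintro ⟨g, rfl⟩
    obtain ⟨f, hf, rfl⟩ := exists_mem_hardySpace_fourierHalfLine_eq g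
    exact ⟨f, hf, synthesisIsometry_fourierHalfLine k f⟩
  · rintro ⟨f, hf, hF⟩
    exact ⟨fourierHalfLine f, Lp.ext ((synthesisIsometry_fourierHalfLine k f).trans hF.symm)⟩

instance completeSpace_waveletSubspace (k : ℕ) : CompleteSpace (waveletSubspace k) := by
  rw [← range_synthesisIsometry k]
  exact (synthesisIsometry k).isometry.isUniformInducing.isComplete_range.completeSpace_coe

/-- The unitary identification of `L²(ℝ₊)` with the wavelet subspace `A^{(k)}`. -/
def waveletEquiv (k : ℕ) : Lp ℂ 2 halfLine ≃ₗᵢ[ℂ] waveletSubspace k :=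
  (synthesisIsometry k).equivRange.trans
    (LinearIsometryEquiv.ofEq _ _ (range_synthesisIsometry k))

theorem waveletEquiv_symm_eq (k : ℕ) {f : Lp ℂ 2 (volume : Measure ℝ)} {F : waveletSubspace k}
    (hF : (F : Lp ℂ 2 affineHaar) =ᵐ[affineHaar] waveletTransform k f) :
    (waveletEquiv k).symm F = fourierHalfLine f := by
  rw [LinearIsometryEquiv.symm_apply_eq]
  exact Subtype.ext (Lp.ext (hF.trans (synthesisIsometry_fourierHalfLine k f).symm))

/-! ### Multiplication operators and representations of `C(X)` -/

section Multiplication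

variable {α : Type*} [MeasurableSpace α] {μ : Measure α}

/-- The operator of pointwise multiplication by `m ∈ L_∞(μ)` on `L²(μ)`. -/
def multiplicationOp (m : Lp ℂ ∞ μ) : Lp ℂ 2 μ →L[ℂ] Lp ℂ 2 μ :=
  (ContinuousLinearMap.mul ℂ ℂ).holderL μ ∞ 2 2 m

theorem coeFn_multiplicationOp (m : Lp ℂ ∞ μ) (f : Lp ℂ 2 μ) :
    multiplicationOp m f =ᵐ[μ] fun x => m x * f x :=
  (ContinuousLinearMap.mul ℂ ℂ).coeFn_holder m f

theorem inner_multiplicationOp_self (m : Lp ℂ ∞ μ) (f : Lp ℂ 2 μ) :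
    inner ℂ f (multiplicationOp m f) = ∫ x, m x * ((‖f x‖ ^ 2 : ℝ) : ℂ) ∂μ := by
  rw [L2.inner_def]
  refine integral_congr_ae ?_
  filter_upwards [coeFn_multiplicationOp m f] with x hx
  rw [hx, RCLike.inner_apply, mul_assoc, Complex.mul_conj, Complex.normSq_eq_norm_sq]

variable {X : Type*} [TopologicalSpace X] [CompactSpace X] [MeasurableSpace X] [BorelSpace X]

theorem memLp_top_continuousMap_comp {φ : α → X} (hφ : Measurable φ) (h : C(X, ℂ)) :
    MemLp (h ∘ φ) ∞ μ :=
  memLp_top_of_bound (h.continuous.measurable.comp hφ).aestronglyMeasurable ‖h‖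
    (.of_forall fun x => h.norm_coe_le_norm (φ x))

theorem coeFn_multiplicationOp_comp {φ : α → X} (hφ : Measurable φ) (h : C(X, ℂ))
    (f : Lp ℂ 2 μ) : multiplicationOp (memLp_top_continuousMap_comp (μ := μ) hφ h).toLp f =ᵐ[μ]
      fun x => h (φ x) * f x := by
  filter_upwards [coeFn_multiplicationOp (memLp_top_continuousMap_comp (μ := μ) hφ h).toLp f,
    (memLp_top_continuousMap_comp (μ := μ) hφ h).coeFn_toLp] with x h1 h2
  rw [h1, h2, Function.comp_apply]

/-- The representation of `C(X)` on `L²(μ)` by the multiplications by the functions `h ∘ φ`, where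
`φ` is a measurable map into the compact space `X`. -/
def multiplicationHom (μ : Measure α) {φ : α → X} (hφ : Measurable φ) :
    C(X, ℂ) →⋆ₐ[ℂ] (Lp ℂ 2 μ →L[ℂ] Lp ℂ 2 μ) :=
  have hc := coeFn_multiplicationOp_comp (μ := μ) hφ
  { toFun := fun h => multiplicationOp (memLp_top_continuousMap_comp hφ h).toLp
    map_one' := by
      refine ContinuousLinearMap.ext fun f => Lp.ext ?_
      filter_upwards [hc 1 f] with x h1
      rw [h1, ContinuousMap.one_apply, one_mul]
      rfl
    map_mul' := fun h₁ h₂ => by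
      refine ContinuousLinearMap.ext fun f => Lp.ext ?_
      rw [mul_apply_eq_comp]
      filter_upwards [hc (h₁ * h₂) f, hc h₂ f, hc h₁ (multiplicationOp
        (memLp_top_continuousMap_comp (μ := μ) hφ h₂).toLp f)] with x e1 e2 e3
      rw [e1, e3, e2, ContinuousMap.mul_apply, mul_assoc]
    map_zero' := by
      refine ContinuousLinearMap.ext fun f => Lp.ext ?_
      filter_upwards [hc 0 f, Lp.coeFn_zero ℂ 2 μ] with x h1 h2
      rw [h1, ContinuousMap.zero_apply, zero_mul, zero_apply, h2,
        Pi.zero_apply]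
    map_add' := fun h₁ h₂ => by
      refine ContinuousLinearMap.ext fun f => Lp.ext ?_
      rw [add_apply]
      filter_upwards [hc (h₁ + h₂) f, hc h₂ f, hc h₁ f, Lp.coeFn_add
        (multiplicationOp (memLp_top_continuousMap_comp (μ := μ) hφ h₁).toLp f)
        (multiplicationOp (memLp_top_continuousMap_comp (μ := μ) hφ h₂).toLp f)]
        with x e1 e2 e3 e4
      rw [e1, e4, Pi.add_apply, e3, e2, ContinuousMap.add_apply, add_mul]
    commutes' := fun c => by
      refine ContinuousLinearMap.ext fun f => Lp.ext ?_
      rw [Algebra.algebraMap_eq_smul_one (A := Lp ℂ 2 μ →L[ℂ] Lp ℂ 2 μ),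
        smul_apply, one_apply_eq_self]
      filter_upwards [hc (algebraMap ℂ C(X, ℂ) c) f, Lp.coeFn_smul c f] with x e1 e2
      rw [e1, e2, Pi.smul_apply, smul_eq_mul]
      rfl
    map_star' := fun h => by
      rw [ContinuousLinearMap.star_eq_adjoint, ContinuousLinearMap.eq_adjoint_iff]
      intro f g
      rw [L2.inner_def, L2.inner_def]
      refine integral_congr_ae ?_
      filter_upwards [hc (star h) f, hc h g] with x e1 e2
      rw [e1, e2, ContinuousMap.star_apply]
      simp only [RCLike.inner_apply, map_mul, RCLike.star_def, RingHomCompTriple.comp_apply,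
        RingHom.id_apply]
      ring }

theorem multiplicationHom_apply {φ : α → X} (hφ : Measurable φ) (h : C(X, ℂ)) :
    multiplicationHom μ hφ h = multiplicationOp (memLp_top_continuousMap_comp hφ h).toLp := rfl

/-- If a multiplication operator on `L²` of a `σ`-finite measure vanishes, so does its symbol. -/
theorem ae_eq_zero_of_multiplicationHom_eq_zero [SigmaFinite μ] {φ : α → X} (hφ : Measurable φ)
    {h : C(X, ℂ)} (h0 : multiplicationHom μ hφ h = 0) : ∀ᵐ x ∂μ, h (φ x) = 0 := by
  have hs : ∀ n, ∀ᵐ x ∂μ, x ∈ spanningSets μ n → h (φ x) = 0 := fun n => by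
    have hμ := (measure_spanningSets_lt_top μ n).ne
    have h1 := coeFn_multiplicationOp_comp (μ := μ) hφ h
      (indicatorConstLp 2 (measurableSet_spanningSets μ n) hμ (1 : ℂ))
    rw [← multiplicationHom_apply hφ, h0, zero_apply] at h1
    filter_upwards [h1, Lp.coeFn_zero ℂ 2 μ, indicatorConstLp_coeFn (p := 2)
      (hs := measurableSet_spanningSets μ n) (hμs := hμ) (c := (1 : ℂ))] with x e1 e2 e3 hx
    rw [e2, e3, indicator_of_mem hx, mul_one] at e1
    exact e1.symm
  filter_upwards [ae_all_iff.mpr hs] with x hx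
  obtain ⟨n, hn⟩ := mem_iUnion.mp ((iUnion_spanningSets μ).symm ▸ mem_univ x)
  exact hx n hn

end Multiplication

/-- The continuous functional calculus in `C(X)` is composition. -/
theorem cfc_continuousMap {X : Type*} [TopologicalSpace X] [CompactSpace X] (h : C(X, ℂ))
    {N : ℂ → ℂ} (hN : ContinuousOn N (range h)) (x : X) : cfc N h x = N (h x) := by
  have hN' : ContinuousOn N (spectrum ℂ h) := by rwa [ContinuousMap.spectrum_eq_range]
  have e := StarAlgHom.map_cfc (S := ℂ) (ContinuousMap.evalStarAlgHom ℂ ℂ x) N h hN'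
    (continuous_eval_const x)
  simp only [ContinuousMap.evalStarAlgHom_apply] at e
  rw [e]
  exact cfc_algebraMap (A := ℂ) (h x) N

open scoped CStarAlgebra in
theorem map_cfc_continuousMap {X A : Type*} [TopologicalSpace X] [CompactSpace X]
    [CStarAlgebra A] (π : C(X, ℂ) →⋆ₐ[ℂ] A) {h : C(X, ℂ)} {f : ℂ → ℂ}
    (hf : ContinuousOn f (range h)) : π (cfc f h) = cfc f (π h) :=
  have hn : IsStarNormal (π h) := (inferInstance : IsStarNormal h).map π
  StarAlgHom.map_cfc π f h (by rwa [ContinuousMap.spectrum_eq_range]) (map_continuous π)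

/-- Spectral permanence for faithful representations of `C(X)`. -/
theorem spectrum_map_continuousMap {X A : Type*} [TopologicalSpace X] [CompactSpace X]
    [CStarAlgebra A] (π : C(X, ℂ) →⋆ₐ[ℂ] A) (hπ : ∀ h, π h = 0 → h = 0) (h : C(X, ℂ)) :
    spectrum ℂ (π h) = range h := by
  refine Subset.antisymm ?_ ?_
  · rw [← ContinuousMap.spectrum_eq_range (𝕜 := ℂ)]
    exact AlgHom.spectrum_apply_subset π h
  · rintro _ ⟨x, rfl⟩
    by_contra hx
    -- a function that vanishes on the spectrum of `π h`, but not at `h x`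
    obtain ⟨f, hf0, hf1, -⟩ := exists_continuous_zero_one_of_isClosed
      (spectrum.isClosed (𝕜 := ℂ) (π h)) (isClosed_singleton (x := h x))
      (disjoint_singleton_right.mpr hx)
    have hc : Continuous fun z => (f z : ℂ) := by fun_prop
    have h1 : cfc (fun z => (f z : ℂ)) (π h) = 0 := by
      rw [cfc_congr (g := fun _ => 0) fun z hz => by simp [hf0 hz], cfc_const_zero]
    have h2 := map_cfc_continuousMap π (h := h) hc.continuousOn
    rw [h1] at h2
    have h3 := cfc_continuousMap h hc.continuousOn x
    rw [hπ _ h2, hf1 rfl] at h3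
    simp at h3

/-! ### The functional calculus of the multiplication by `1 - e^{-2λξ}` -/

/-- The function `ξ ↦ 1 - e^{-2λξ}` with values in `[0, 1]`. -/
def expSymbol (lam ξ : ℝ) : Icc (0 : ℝ) 1 :=
  projIcc 0 1 zero_le_one (1 - Real.exp (-(2 * lam * ξ)))

theorem continuous_expSymbol (lam : ℝ) : Continuous (expSymbol lam) :=
  continuous_projIcc.comp (by fun_prop)

theorem one_sub_exp_mem_Ioo {lam ξ : ℝ} (hlam : 0 < lam) (hξ : 0 < ξ) :
    1 - Real.exp (-(2 * lam * ξ)) ∈ Ioo (0 : ℝ) 1 :=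
  ⟨sub_pos.mpr (by rw [Real.exp_lt_one_iff]; exact neg_neg_of_pos (by positivity)),
    sub_lt_self _ (Real.exp_pos _)⟩

theorem coe_expSymbol {lam ξ : ℝ} (hlam : 0 < lam) (hξ : 0 < ξ) :
    (expSymbol lam ξ : ℝ) = 1 - Real.exp (-(2 * lam * ξ)) := by
  rw [expSymbol, projIcc_of_mem _ (Ioo_subset_Icc_self (one_sub_exp_mem_Ioo hlam hξ))]

theorem frequency_one_sub_exp {lam : ℝ} (hlam : 0 < lam) (ξ : ℝ) :
    frequency lam (1 - Real.exp (-(2 * lam * ξ))) = ξ := by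
  rw [frequency, sub_sub_cancel, Real.log_exp]
  field_simp

theorem one_sub_exp_frequency {lam x : ℝ} (hlam : 0 < lam) (hx : x ∈ Ioo (0 : ℝ) 1) :
    1 - Real.exp (-(2 * lam * frequency lam x)) = x := by
  have : -(2 * lam * frequency lam x) = Real.log (1 - x) := by
    rw [frequency]; field_simp
  rw [this, Real.exp_log (by linarith [hx.2]), sub_sub_cancel]

/-- The representation of `C([0, 1])` on `L²(ℝ₊)` that maps the identity to the multiplication by
`1 - e^{-2λξ}`. -/
def expHom (lam : ℝ) : C(Icc (0 : ℝ) 1, ℂ) →⋆ₐ[ℂ] (Lp ℂ 2 halfLine →L[ℂ] Lp ℂ 2 halfLine) :=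
  multiplicationHom halfLine (continuous_expSymbol lam).measurable

theorem expHom_injective {lam : ℝ} (hlam : 0 < lam) (h : C(Icc (0 : ℝ) 1, ℂ))
    (h0 : expHom lam h = 0) : h = 0 := by
  have h1 : ∀ᵐ ξ ∂halfLine, h (expSymbol lam ξ) = 0 :=
    ae_eq_zero_of_multiplicationHom_eq_zero _ h0
  have h2 : EqOn (fun ξ => h (expSymbol lam ξ)) (fun _ => 0) (Ioi 0) :=
    Measure.eqOn_open_of_ae_eq h1 isOpen_Ioi
      (h.continuous.comp (continuous_expSymbol lam)).continuousOn continuousOn_const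
  have h3 : EqOn (fun x => h (projIcc 0 1 zero_le_one x)) (fun _ => 0) (Ioo 0 1) := fun x hx => by
    have := h2 (frequency_pos hlam hx)
    simpa only [expSymbol, one_sub_exp_frequency hlam hx] using this
  have h4 := h3.closure (h.continuous.comp continuous_projIcc) continuous_const
  rw [closure_Ioo zero_ne_one] at h4
  ext x
  simpa using h4 x.2

/-- The inclusion of `[0, 1]` into `ℂ`. -/
def unitIntervalCoe : C(Icc (0 : ℝ) 1, ℂ) := ⟨fun x => ((x : ℝ) : ℂ), by fun_prop⟩

theorem isSelfAdjoint_unitIntervalCoe : IsSelfAdjoint unitIntervalCoe := by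
  ext x
  exact Complex.conj_ofReal _

theorem range_unitIntervalCoe : range unitIntervalCoe = Complex.ofReal '' Icc (0 : ℝ) 1 := by
  ext z
  constructor
  · rintro ⟨x, rfl⟩
    exact ⟨x, x.2, rfl⟩
  · rintro ⟨x, hx, rfl⟩
    exact ⟨⟨x, hx⟩, rfl⟩

/-! ### Calderón–Toeplitz operators as multiplication operators -/

/-- The quadratic form of a Calderón–Toeplitz operator with a symbol depending on `v` only, in the
coordinates given by the Fourier transform. -/
theorem inner_toeplitz_waveletEquiv (k : ℕ) {a : ℝ → ℂ} (ha : MemLp a ∞ halfLine)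
    (g : Lp ℂ 2 halfLine) :
    inner ℂ (waveletEquiv k g) (toeplitz k (verticalSymbol ha) (waveletEquiv k g)) =
      ∫ ξ in Ioi (0 : ℝ), spectralFunction k a ξ * ((‖g ξ‖ ^ 2 : ℝ) : ℂ) := by
  have h1 : inner ℂ (waveletEquiv k g) (toeplitz k (verticalSymbol ha) (waveletEquiv k g)) =
      inner ℂ (synthesisIsometry k g)
        (multiplicationOp (verticalSymbol ha) (synthesisIsometry k g)) :=
    Submodule.inner_orthogonalProjectionOnto_eq_of_mem_left _ _
  rw [h1, inner_multiplicationOp_self, ← integral_mul_norm_synthesis_sq k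
    (Lp.stronglyMeasurable g).measurable (Lp.memLp g) ha]
  refine integral_congr_ae ?_
  filter_upwards [(memLp_vertical ha).coeFn_toLp, coeFn_synthesisIsometry k g] with p e1 e2
  rw [e2, verticalSymbol, e1]

/-- A bounded operator on a complex Hilbert space is determined by its quadratic form. -/
theorem ext_of_inner_self {E : Type*} [NormedAddCommGroup E] [InnerProductSpace ℂ E]
    {S T : E →L[ℂ] E} (h : ∀ x, inner ℂ x (S x) = inner ℂ x (T x)) : S = T := by
  rw [← ContinuousLinearMap.coe_inj, ← ext_inner_map]
  intro x
  exact (inner_conj_symm _ _).symm.trans ((congrArg _ (h x)).trans (inner_conj_symm _ _))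

/-- In the coordinates given by the Fourier transform, `T_a^{(k)}` is the multiplication by `γ_a`,
written as a function of `1 - e^{-2λξ}`. -/
theorem conj_waveletEquiv_expHom (k : ℕ) {a : ℝ → ℂ} (ha : MemLp a ∞ halfLine) {lam : ℝ}
    {h : C(Icc (0 : ℝ) 1, ℂ)}
    (hh : ∀ ξ, 0 < ξ → h (expSymbol lam ξ) = spectralFunction k a ξ) :
    (waveletEquiv k).conjStarAlgEquiv (expHom lam h) = toeplitz k (verticalSymbol ha) := by
  refine ext_of_inner_self fun F => ?_
  obtain ⟨g, rfl⟩ := (waveletEquiv k).surjective F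
  refine Eq.trans ?_ (inner_toeplitz_waveletEquiv k ha g).symm
  have h1 : inner ℂ (waveletEquiv k g)
      ((waveletEquiv k).conjStarAlgEquiv (expHom lam h) (waveletEquiv k g)) =
      inner ℂ g (expHom lam h g) := by
    rw [LinearIsometryEquiv.conjStarAlgEquiv_apply_apply, LinearIsometryEquiv.symm_apply_apply,
      LinearIsometryEquiv.inner_map_map]
  refine h1.trans ?_
  rw [expHom, multiplicationHom_apply, inner_multiplicationOp_self]
  refine integral_congr_ae ?_
  filter_upwards [(memLp_top_continuousMap_comp (μ := halfLine)
    (continuous_expSymbol lam).measurable h).coeFn_toLp, ae_restrict_mem measurableSet_Ioi]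
    with ξ e1 hξ
  rw [e1, Function.comp_apply, hh ξ hξ]

theorem toeplitz_chi_eq {lam : ℝ} (hlam : 0 < lam) :
    toeplitz 0 (verticalSymbol (memLp_chi lam)) =
      (waveletEquiv 0).conjStarAlgEquiv (expHom lam unitIntervalCoe) := by
  refine (conj_waveletEquiv_expHom 0 (memLp_chi lam) fun ξ hξ => ?_).symm
  rw [spectralFunction_chi hlam, ← coe_expSymbol hlam hξ]
  rfl

/-- The functional calculus of `T^{(0)}_{χ_{[0,λ]}}`, carried out in `C([0, 1])`. -/
theorem opCfc_toeplitz_chi {lam : ℝ} (hlam : 0 < lam) {f : ℂ → ℂ}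
    (hf : ContinuousOn f (range unitIntervalCoe)) :
    opCfc f (toeplitz 0 (verticalSymbol (memLp_chi lam))) =
      (waveletEquiv 0).conjStarAlgEquiv (expHom lam (cfc f unitIntervalCoe)) := by
  rw [toeplitz_chi_eq hlam]
  let Φ : C(Icc (0 : ℝ) 1, ℂ) →⋆ₐ[ℂ] (waveletSubspace 0 →L[ℂ] waveletSubspace 0) :=
    ((waveletEquiv 0).conjStarAlgEquiv : (Lp ℂ 2 halfLine →L[ℂ] Lp ℂ 2 halfLine) →⋆ₐ[ℂ]
      (waveletSubspace 0 →L[ℂ] waveletSubspace 0)).comp (expHom lam)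
  exact (map_cfc_continuousMap
    (A := waveletSubspace 0 →L[ℂ] waveletSubspace 0) Φ hf).symm

end

theorem mainTheorem5 (k : ℕ) (lam : ℝ) (hlam : 0 < lam) (a : ℝ → ℂ) (ha : MemLp a ∞ halfLine)
    (a₀ aInf : ℂ) (ha₀ : Tendsto a (ae halfLine ⊓ 𝓝 0) (𝓝 a₀))
    (haInf : Tendsto a (ae halfLine ⊓ atTop) (𝓝 aInf)) :
    -- the wavelet subspaces are closed, so that the operators on them are well defined
    ∃ _ : ∀ j : ℕ, CompleteSpace (waveletSubspace j),
      IsSelfAdjoint (toeplitz 0 (verticalSymbol (memLp_chi lam))) ∧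
      spectrum ℂ (toeplitz 0 (verticalSymbol (memLp_chi lam))) =
        Complex.ofReal '' Icc (0 : ℝ) 1 ∧
      (∀ x ∈ Ioo (0 : ℝ) 1, IntegrableOn (nablaIntegrand a lam k x) (Ioi 0)) ∧
      -- `N` is the continuous extension of the function `∇` to `[0, 1]`
      ∃ N : ℝ → ℂ, ContinuousOn N (Icc 0 1) ∧ EqOn N (nabla a lam k) (Ioo 0 1) ∧
        N 0 = aInf ∧ N 1 = a₀ ∧
        -- `V` identifies the levels `0` and `k` through the wavelet transforms
        ∃ V : waveletSubspace 0 ≃ₗᵢ[ℂ] waveletSubspace k,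
          (∀ f ∈ hardySpace, ∀ F : waveletSubspace 0,
            (F : Lp ℂ 2 affineHaar) =ᵐ[affineHaar] waveletTransform 0 f →
            (V F : Lp ℂ 2 affineHaar) =ᵐ[affineHaar] waveletTransform k f) ∧
          V.conjStarAlgEquiv (opCfc (fun z : ℂ => N z.re)
              (toeplitz 0 (verticalSymbol (memLp_chi lam)))) =
            toeplitz k (verticalSymbol ha) := by
  refine ⟨completeSpace_waveletSubspace, ?_, ?_,
    fun x hx => integrableOn_nablaIntegrand ha hlam k hx, ?_⟩
  · rw [toeplitz_chi_eq hlam]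
    exact (isSelfAdjoint_unitIntervalCoe.map (expHom lam)).map
      (waveletEquiv 0).conjStarAlgEquiv
  · rw [toeplitz_chi_eq hlam, AlgEquiv.spectrum_eq (waveletEquiv 0).conjStarAlgEquiv,
      spectrum_map_continuousMap (expHom lam) (expHom_injective hlam), range_unitIntervalCoe]
  obtain ⟨N, hN, hNn, hN0, hN1⟩ := exists_continuousOn_extension_nabla k hlam ha ha₀ haInf
  refine ⟨N, hN, hNn, hN0, hN1, (waveletEquiv 0).symm.trans (waveletEquiv k), ?_, ?_⟩
  · intro f _ F hF
    rw [LinearIsometryEquiv.trans_apply, waveletEquiv_symm_eq 0 hF]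
    exact synthesisIsometry_fourierHalfLine k f
  · set N' : ℂ → ℂ := fun z => N z.re
    have hN' : ContinuousOn N' (range unitIntervalCoe) := by
      refine hN.comp Complex.continuous_re.continuousOn ?_
      rintro _ ⟨x, rfl⟩
      exact x.2
    rw [opCfc_toeplitz_chi hlam hN', LinearIsometryEquiv.conjStarAlgEquiv_trans,
      StarAlgEquiv.trans_apply, ← LinearIsometryEquiv.symm_conjStarAlgEquiv, StarAlgEquiv.symm_apply_apply]
    refine conj_waveletEquiv_expHom k ha fun ξ hξ => ?_
    have hx := one_sub_exp_mem_Ioo hlam hξ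
    rw [cfc_continuousMap _ hN']
    change N (expSymbol lam ξ : ℝ) = _
    rw [coe_expSymbol hlam hξ, hNn hx, nabla_eq_spectralFunction a hlam k hx,
      frequency_one_sub_exp hlam]
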